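/- **Setting.** Consider the noise-free plant $x(t+1)=f(x(t),u(t))$ with $x(t)\in\mathbb R^{l_s}$, $u(t)\in\mathbb R^{l_u}$, $t\in\mathbb N_0$. A function $\psi:\mathbb R_{\ge0}\to\mathbb R_{\ge0}$ is of class $\mathcal K_\infty$ if it is continuous, strictly increasing and zero at zero. The plant is *stochastically stable* if $\sum_{k=0}^\infty \mathsf E[\psi(|x(k)|)]<\infty$ for some $\psi\in\mathcal K_\infty$. *Network.* $C(t)=(B(t),B'(t),N(t))$ takes values in $\{0,\dots,\bar B\}\times\{1,\dots,\bar B'\}\times\{0,\dots,\bar N\}$ and is a time-homogeneous Markov chain. The controller-actuator transmission at time $t$ succeeds ($\gamma(t)=1$) or fails ($\gamma(t)=0$), failing with probability $\bar\gamma\in(0,1]$; the sensor-controller transmission succeeds ($\gamma'(t)=1$) or fails ($\gamma'(t)=0$), failing with probability $g(h_{B'(t)})\in[0,1]$, where $h_1,\dots,h_{\bar B'}$ are the channel power gains and $g$ is the drop probability as a function of the gain. Given the chain $C$, all these outcomes are independent; $x(0)$ is independent of $C$, $\gamma$, $\gamma'$. *Buffers.* The controller and the actuator have buffers of lengths $\Lambda_c$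 and $\Lambda_a$, with $\Lambda_a\le\Lambda_c$ and $\bar N\le\Lambda_c$; $\lambda_c(t)$, $\lambda_a(t)$ are their effective lengths after transmission at time $t$. The number of transmitted commands at time $t\ge1$ is $L(t)=\min\{B(t),N(t),\Lambda_a\}$ if $\gamma'(t)N(t)>0$; $L(t)=\min\{B(t),\lambda_c(t-1),\Lambda_a-\lambda_a(t-1)\}$ if $\gamma'(t)N(t)=0$ and $\lambda_a(t-1)\ne0$; and $L(t)=0$ otherwise. For a control policy $\kappa$, if $\gamma'(t)N(t)>0$ the controller computes $u_i=\kappa(x'_i)$, $1\le i\le N(t)$, with $x_1'=x(t)$, $x'_{i+1}=f(x'_i,u_i)$. - If $\gamma'(t)N(t)>0$ and $\gamma(t)=1$, the actuator's buffer becomes $(u_1,\dots,u_{L(t)})$ and the controller's buffer becomes $(u_{L(t)+1},\dots,u_{N(t)})$. - If $\gamma'(t)N(t)>0$ and $\gamma(t)=0$, the controller's buffer is erased and the actuator's buffer drops its first entry (if any). - If $\gamma'(t)N(t)=0$ and $\lambda_a(t-1)=0$, the controller's buffer is erased and the actuator's buffer stays empty. - If $\gamma'(t)N(t)=0$, $\lambda_a(t-1)\neq0$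 and $\gamma(t)=1$, the actuator's buffer drops its first entry, and the first $L(t)$ entries of the controller's buffer are moved to its end. - If $\gamma'(t)N(t)=0$, $\lambda_a(t-1)\neq0$ and $\gamma(t)=0$, the actuator's buffer drops its first entry and the controller's buffer is unchanged. The input $u(t)$ is the first entry of the actuator's buffer after this update, and $u(t)=0$ if that buffer is empty. **Assumptions.** 1. There are $V:\mathbb R^{l_s}\to\mathbb R_{\ge0}$, $\psi_1,\psi_2\in\mathcal K_\infty$, $\rho\in(0,1)$ and $\kappa:\mathbb R^{l_s}\to\mathbb R^{l_u}$ with $\psi_1(|x|)\le V(x)\le\psi_2(|x|)$ and $V(f(x,\kappa(x)))\le\rho V(x)$ for all $x$; this $\kappa$ is the policy used. 2. There is $\alpha>0$ with $V(f(x,0))\le\alpha V(x)$ for all $x$, and $\mathsf E[\psi_2(|x(0)|)]<\infty$. 3. The Markov chain $C$ is irreducible and aperiodic. 4. Both buffers are empty at time $0$ ($\lambda_c(0)=\lambda_a(0)=0$) and $C(0)=(B_0,B'_0,N_0)$ is a given state. **Notation.** Let $Z(t)=(\lambda_c(t),\lambda_a(t),B(t+1),B'(t+1),N(t+1))$, let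 $\mathcal S$ be the finite set of states that $Z$ visits with positive probability, $\mathcal S_0\subseteq\mathcal S$ those with $\lambda_a=0$, and $\mathbf V=\begin{bmatrix}\mathbf V_{0,0}&\mathbf V_{0,1}\\ \mathbf V_{1,0}&\mathbf V_{1,1}\end{bmatrix}$ the transition matrix of $Z$ on $\mathcal S$, in blocks according to $\mathcal S_0$ and $\mathcal S\setminus\mathcal S_0$. Put $\mathbf D(1)=\mathbf V_{0,0}$, $\mathbf D(l)=\mathbf V_{0,1}\mathbf V_{1,1}^{\,l-2}\mathbf V_{1,0}$ for $l\ge2$, and $\tilde{\mathbf V}=\sum_{l\ge1}\mathbf D(l)$. Let $k_0<k_1<\cdots$ be the times $t$ with $\lambda_a(t)=0$ and $\Delta_{n+1}=k_{n+1}-k_n$. For $s_i,s_j\in\mathcal S_0$ let $$r_{i,j}=\frac{\sum_{l\ge1}\rho^l[\mathbf D(l)]_{i,j}}{[\tilde{\mathbf V}]_{i,j}},\qquad r_{i,j}=0\ \text{ if }[\tilde{\mathbf V}]_{i,j}=0.$$ **Theorem.** Under Assumptions 1–4: - Almost surely there are infinitely many times $t$ with $\lambda_a(t)=0$. For all $s_i,s_j\in\mathcal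 S_0$ and every $n\in\mathbb N_0$ for which the conditioning event has positive probability, $\mathsf E[\rho^{\Delta_{n+1}}\mid Z(k_n)=s_i,\,Z(k_{n+1})=s_j]=r_{i,j}$; and if $[\tilde{\mathbf V}]_{i,j}\ne0$, there is such an $n$. - If $\Omega'=\dfrac{\alpha}{\rho}\max_{i,j}r_{i,j}<1$, then the plant is stochastically stable. -/

import Mathlib

open MeasureTheory ProbabilityTheory Filter
open scoped NNReal ENNReal BigOperators

noncomputable section

namespace Anytime

/-! ### Plant, comparison functions, stability -/

/-- Euclidean space of column vectors. -/
abbrev Vec (n : ℕ) : Type := EuclideanSpace ℝ (Fin n)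

/-- Class-K-infinity functions in the sense used here: continuous, strictly increasing and
zero at zero, as functions on the nonnegative reals. -/
structure ClassK (ψ : ℝ≥0 → ℝ≥0) : Prop where
  continuous : Continuous ψ
  strictMono : StrictMono ψ
  map_zero : ψ 0 = 0

/-- Stochastic stability of a state process: `∑ₖ E[ψ(|x(k)|)] < ∞` for some `ψ` of class K. -/
def StochasticallyStable {Ω : Type*} [MeasurableSpace Ω] (μ : Measure Ω) {ls : ℕ}
    (x : ℕ → Ω → Vec ls) : Prop :=
  ∃ ψ : ℝ≥0 → ℝ≥0, ClassK ψ ∧ ∑' k : ℕ, ∫⁻ ω, (ψ ‖x k ω‖₊ : ℝ≥0∞) ∂μ < ∞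

/-- The plant `f` is globally controllable in closed loop: `V` is a Lyapunov function for the
policy `κ`, with contraction factor `ρ ∈ (0,1)` and comparison functions `ψ₁`, `ψ₂`. -/
structure LyapunovControllable {ls lu : ℕ} (f : Vec ls → Vec lu → Vec ls)
    (V : Vec ls → ℝ≥0) (ψ₁ ψ₂ : ℝ≥0 → ℝ≥0) (ρ : ℝ) (κ : Vec ls → Vec lu) : Prop where
  classK₁ : ClassK ψ₁
  classK₂ : ClassK ψ₂
  rho_pos : 0 < ρ
  rho_lt_one : ρ < 1
  lower : ∀ x, ψ₁ ‖x‖₊ ≤ V x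
  upper : ∀ x, V x ≤ ψ₂ ‖x‖₊
  contract : ∀ x, (V (f x (κ x)) : ℝ) ≤ ρ * V x

/-- Open-loop growth bound: with zero input, `V` grows at most by the factor `α > 0`. -/
structure OpenLoopBound {ls lu : ℕ} (f : Vec ls → Vec lu → Vec ls)
    (V : Vec ls → ℝ≥0) (α : ℝ) : Prop where
  alpha_pos : 0 < α
  growth : ∀ x, (V (f x 0) : ℝ) ≤ α * V x

/-! ### Network and computation parameters -/

/-- Aperiodicity of a chain with transition matrix `P`: for each state, the greatest common
divisor of the possible return times is `1`. -/
def Aperiodic {ι : Type*} [Fintype ι] [DecidableEq ι] (P : Matrix ι ι ℝ) : Prop :=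
  ∀ i, ∀ d : ℕ, (∀ t : ℕ, 0 < t → 0 < (P ^ t) i i → d ∣ t) → d = 1

/-- Parameters of the dual-channel-dual-buffer network. The joint state of the
controller-actuator channel `B ∈ {0,…,Bmax}`, the sensor-controller channel index `B'` (one of
`Bgain` values) and the number `N ∈ {0,…,Nmax}` of commands that can be computed is an element
of `Fin (Bmax + 1) × Fin Bgain × Fin (Nmax + 1)`. -/
structure Network where
  /-- length of the controller's buffer -/
  Λc : ℕ
  /-- length of the actuator's buffer -/
  Λa : ℕ
  Bmax : ℕ
  Bgain : ℕ
  Nmax : ℕ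
  Λa_le : Λa ≤ Λc
  Nmax_le : Nmax ≤ Λc
  /-- transition matrix of `(B, B', N)` -/
  P : Matrix (Fin (Bmax + 1) × Fin Bgain × Fin (Nmax + 1))
    (Fin (Bmax + 1) × Fin Bgain × Fin (Nmax + 1)) ℝ
  P_stochastic : P ∈ Matrix.rowStochastic ℝ (Fin (Bmax + 1) × Fin Bgain × Fin (Nmax + 1))
  /-- initial value of `(B, B', N)` -/
  c₀ : Fin (Bmax + 1) × Fin Bgain × Fin (Nmax + 1)
  /-- packet drop probability of the controller-actuator channel -/
  dropCA : ℝ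
  dropCA_pos : 0 < dropCA
  dropCA_le_one : dropCA ≤ 1
  /-- power gains of the sensor-controller channel -/
  gain : Fin Bgain → ℝ
  /-- packet drop probability as a function of the power gain -/
  dropOfGain : ℝ → ℝ
  dropOfGain_nonneg : ∀ b, 0 ≤ dropOfGain (gain b)
  dropOfGain_le_one : ∀ b, dropOfGain (gain b) ≤ 1

namespace Network

variable (net : Network)

/-- Joint values of `(B, B', N)`. -/
abbrev Chan : Type := Fin (net.Bmax + 1) × Fin net.Bgain × Fin (net.Nmax + 1)

/-- The value of `B`. -/
def Bof {net : Network} (c : net.Chan) : ℕ := c.1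

/-- The value of `N`. -/
def Nof {net : Network} (c : net.Chan) : ℕ := c.2.2

/-- Drop probability of the sensor-controller channel in the joint state `c`. -/
def dropSC {net : Network} (c : net.Chan) : ℝ := net.dropOfGain (net.gain c.2.1)

/-- `γ' N > 0`: the measurement arrived and the processor computes at least one command. -/
abbrev Fresh {net : Network} (c : net.Chan) (g' : Bool) : Prop := g' = true ∧ 0 < Nof c

/-- Number `L(t)` of commands transmitted to the actuator, from the previous effective buffer
lengths `lc`, `la`, the current joint state `c` and the success `g'` of the sensor-controller
transmission. -/
def numSent (lc la : ℕ) (c : net.Chan) (g' : Bool) : ℕ :=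
  if Fresh c g' then min (Bof c) (min (Nof c) net.Λa)
  else if la ≠ 0 then min (Bof c) (min lc (net.Λa - la))
  else 0

/-! ### Effective buffer lengths and the chain `Z` -/

/-- Update of the controller's effective buffer length. -/
def nextLc (lc la : ℕ) (c : net.Chan) (g g' : Bool) : ℕ :=
  if Fresh c g' then
    if g = true then Nof c - net.numSent lc la c g' else 0
  else if la = 0 then 0
  else if g = true then lc - net.numSent lc la c g'
  else lc

/-- Update of the actuator's effective buffer length. -/
def nextLa (lc la : ℕ) (c : net.Chan) (g g' : Bool) : ℕ :=
  if g = false then la - 1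
  else if Fresh c g' then net.numSent lc la c g'
  else if la = 0 then 0
  else la + net.numSent lc la c g' - 1

/-- Probability of the transmission outcome `b` (`true` is success) at drop probability `q`. -/
def outcomeProb (q : ℝ) (b : Bool) : ℝ := if b = true then 1 - q else q

/-- States of `Z(t) = (λc(t), λa(t), B(t+1), B'(t+1), N(t+1))`. -/
abbrev ZState : Type := Fin (net.Λc + 1) × Fin (net.Λa + 1) × net.Chan

/-- Transition probabilities of `Z`: the outcomes of the two transmissions are drawn given the
joint state stored in `z`, the buffer lengths are updated, and the joint state moves by `P`. -/
def transZ : Matrix net.ZState net.ZState ℝ := fun z z' =>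
  net.P z.2.2 z'.2.2 *
    ∑ g : Bool, ∑ g' : Bool,
      if net.nextLc z.1 z.2.1 z.2.2 g g' = z'.1 ∧ net.nextLa z.1 z.2.1 z.2.2 g g' = z'.2.1
      then outcomeProb net.dropCA g * outcomeProb (dropSC z.2.2) g' else 0

/-- The states in the set `𝒮`: those visited by `Z` with positive probability, when both buffers
are empty at time `0` and `(B(0), B'(0), N(0)) = c₀`. -/
def Visited (z : net.ZState) : Prop :=
  ∃ (c : net.Chan) (t : ℕ), 0 < net.P net.c₀ c ∧ 0 < (net.transZ ^ t) (0, 0, c) z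

/-- The states of `𝒮₀`: visited states with an empty actuator buffer. -/
def In0 (z : net.ZState) : Prop := net.Visited z ∧ z.2.1 = 0

/-- The states of `𝒮₁ = 𝒮 \ 𝒮₀`. -/
def In1 (z : net.ZState) : Prop := net.Visited z ∧ z.2.1 ≠ 0

/-- The set `𝒮₀` as a type. -/
abbrev S0 : Type := {z : net.ZState // net.In0 z}

/-- The set `𝒮₁` as a type. -/
abbrev S1 : Type := {z : net.ZState // net.In1 z}

instance : Fintype net.S0 := Fintype.ofFinite _

instance : Fintype net.S1 := Fintype.ofFinite _

instance : DecidableEq net.S1 := Classical.decEq _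

/-- The block `V_{0,0}` of the transition matrix of `Z` restricted to `𝒮 = 𝒮₀ ∪ 𝒮₁`. -/
def V00 : Matrix net.S0 net.S0 ℝ := net.transZ.toBlock net.In0 net.In0

/-- The block `V_{0,1}`. -/
def V01 : Matrix net.S0 net.S1 ℝ := net.transZ.toBlock net.In0 net.In1

/-- The block `V_{1,0}`. -/
def V10 : Matrix net.S1 net.S0 ℝ := net.transZ.toBlock net.In1 net.In0

/-- The block `V_{1,1}`. -/
def V11 : Matrix net.S1 net.S1 ℝ := net.transZ.toBlock net.In1 net.In1

/-- `D(l)` for `l ≥ 1`: the first-return matrices to `𝒮₀`. The value at `l = 0` is not used. -/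
def D : ℕ → Matrix net.S0 net.S0 ℝ
  | 0 => 0
  | 1 => net.V00
  | l + 2 => net.V01 * net.V11 ^ l * net.V10

/-- The matrix `Ṽ = ∑_{l ≥ 1} D(l)`. -/
def Vtilde : Matrix net.S0 net.S0 ℝ := fun i j => ∑' l : ℕ, net.D (l + 1) i j

/-- `r i j = (∑_{l ≥ 1} ρ ^ l D(l) i j) / Ṽ i j`, with value `0` if `Ṽ i j = 0`, which is the
convention for conditioning on a null event. -/
def r (ρ : ℝ) (i j : net.S0) : ℝ :=
  (∑' l : ℕ, ρ ^ (l + 1) * net.D (l + 1) i j) / net.Vtilde i j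

/-- `Ω' = (α / ρ) max_{i,j} r i j`; the supremum is over a finite nonempty set. -/
def OmegaPrime (α ρ : ℝ) : ℝ := α / ρ * ⨆ p : net.S0 × net.S0, net.r ρ p.1 p.2

end Network

/-! ### The anytime control loop -/

/-- The tentative commands `u₁, …, u_n` computed from the state `x`: `u_i = κ(x'_i)` with
`x'_1 = x` and `x'_{i+1} = f(x'_i, u_i)`. -/
def plan {ls lu : ℕ} (f : Vec ls → Vec lu → Vec ls) (κ : Vec ls → Vec lu) :
    ℕ → Vec ls → List (Vec lu)
  | 0, _ => []
  | n + 1, x => κ x :: plan f κ n (f x (κ x))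

/-- Plant state and buffers at a time step. A buffer is stored as the list of its effective
entries (the remaining entries of the buffer are zero), so that shifting it by `L` steps is
`List.drop L` and its effective length is the length of the list. The buffers are those after
the transmission phase and before the control input is applied. -/
structure LoopState (ls lu : ℕ) where
  x : Vec ls
  bc : List (Vec lu)
  ba : List (Vec lu)

/-- The input applied: the first entry of the actuator's buffer, zero if the buffer is empty. -/
def LoopState.input {ls lu : ℕ} (s : LoopState ls lu) : Vec lu := s.ba.headD 0

/-- The new controller's buffer; `x` is the current plant state, `bc`, `ba` the previous
buffers, `c` the current joint state, `g`, `g'` the outcomes of the controller-actuator and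
sensor-controller transmissions. -/
def nextBc {ls lu : ℕ} (net : Network) (f : Vec ls → Vec lu → Vec ls) (κ : Vec ls → Vec lu)
    (x : Vec ls) (bc ba : List (Vec lu)) (c : net.Chan) (g g' : Bool) : List (Vec lu) :=
  let L := net.numSent bc.length ba.length c g'
  if Network.Fresh c g' then
    if g = true then (plan f κ (Network.Nof c) x).drop L else []
  else if ba.length = 0 then []
  else if g = true then bc.drop L
  else bc

/-- The new actuator's buffer; the arguments are as for `nextBc`. -/
def nextBa {ls lu : ℕ} (net : Network) (f : Vec ls → Vec lu → Vec ls) (κ : Vec ls → Vec lu)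
    (x : Vec ls) (bc ba : List (Vec lu)) (c : net.Chan) (g g' : Bool) : List (Vec lu) :=
  let L := net.numSent bc.length ba.length c g'
  if g = false then ba.tail
  else if Network.Fresh c g' then (plan f κ (Network.Nof c) x).take L
  else if ba.length = 0 then []
  else ba.tail ++ bc.take L

/-- Evolution of plant and buffers from the plant state `x₀` and empty buffers, along given
sequences of joint states `c` and transmission outcomes `g`, `g'`. -/
def evolve {ls lu : ℕ} (net : Network) (f : Vec ls → Vec lu → Vec ls) (κ : Vec ls → Vec lu)
    (x₀ : Vec ls) (c : ℕ → net.Chan) (g g' : ℕ → Bool) : ℕ → LoopState ls lu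
  | 0 => ⟨x₀, [], []⟩
  | t + 1 =>
    let s := evolve net f κ x₀ c g g' t
    let x := f s.x s.input
    ⟨x, nextBc net f κ x s.bc s.ba (c (t + 1)) (g (t + 1)) (g' (t + 1)),
      nextBa net f κ x s.bc s.ba (c (t + 1)) (g (t + 1)) (g' (t + 1))⟩

/-! ### Random evolution -/

/-- The random data driving the loop: the initial plant state `x₀`, the joint process
`C = (B, B', N)` and the transmission outcomes `γ` (controller-actuator) and `γ'`
(sensor-controller). Their law is given on cylinder events: `C` is a Markov chain with
transition matrix `P` started at `c₀`; given `C`, the outcomes are independent, `γ(t)` fails with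
probability `dropCA` and `γ'(t)` with the drop probability of the current sensor-controller
channel state; and `x₀` is independent of all of these. -/
structure IsDrivingProcess {Ω : Type*} [MeasurableSpace Ω] (μ : Measure Ω) (net : Network)
    {ls : ℕ} (x₀ : Ω → Vec ls) (C : ℕ → Ω → net.Chan) (γ γ' : ℕ → Ω → Bool) : Prop where
  measurable_x₀ : Measurable x₀
  measurable_C : ∀ t, Measurable (C t)
  measurable_γ : ∀ t, Measurable (γ t)
  measurable_γ' : ∀ t, Measurable (γ' t)
  law : ∀ (A : Set (Vec ls)), MeasurableSet A →
    ∀ (T : ℕ) (c : ℕ → net.Chan) (g g' : ℕ → Bool),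
      μ.real {ω | x₀ ω ∈ A ∧ ∀ t ≤ T, C t ω = c t ∧ γ t ω = g t ∧ γ' t ω = g' t} =
        μ.real (x₀ ⁻¹' A) * (if c 0 = net.c₀ then 1 else 0) *
          (∏ t ∈ Finset.range T, net.P (c t) (c (t + 1))) *
          ∏ t ∈ Finset.range (T + 1),
            Network.outcomeProb net.dropCA (g t) *
              Network.outcomeProb (Network.dropSC (c t)) (g' t)

section Loop

variable {Ω : Type*} {ls lu : ℕ} (net : Network) (f : Vec ls → Vec lu → Vec ls)
  (κ : Vec ls → Vec lu) (x₀ : Ω → Vec ls) (C : ℕ → Ω → net.Chan) (γ γ' : ℕ → Ω → Bool)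

/-- Plant and buffers at time `t`, as a random element. -/
def loop (t : ℕ) (ω : Ω) : LoopState ls lu :=
  evolve net f κ (x₀ ω) (fun s => C s ω) (fun s => γ s ω) (fun s => γ' s ω) t

/-- The plant state `x(t)`. -/
def state (t : ℕ) (ω : Ω) : Vec ls := (loop net f κ x₀ C γ γ' t ω).x

/-- The effective length `λc(t)` of the controller's buffer. -/
def lamC (t : ℕ) (ω : Ω) : ℕ := (loop net f κ x₀ C γ γ' t ω).bc.length

/-- The effective length `λa(t)` of the actuator's buffer. -/
def lamA (t : ℕ) (ω : Ω) : ℕ := (loop net f κ x₀ C γ γ' t ω).ba.length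

/-- The event `Z(t) = z`, where `Z(t) = (λc(t), λa(t), B(t+1), B'(t+1), N(t+1))`. -/
def ZEq (t : ℕ) (ω : Ω) (z : net.ZState) : Prop :=
  lamC net f κ x₀ C γ γ' t ω = z.1 ∧ lamA net f κ x₀ C γ γ' t ω = z.2.1 ∧ C (t + 1) ω = z.2.2

/-- `k_n`: the `n`-th time (counted from `0`) at which the actuator's buffer is empty. -/
def k (n : ℕ) (ω : Ω) : ℕ := Nat.nth (fun t => lamA net f κ x₀ C γ γ' t ω = 0) n

/-- The cycle length `Δ_{n+1} = k_{n+1} - k_n`, as a function of `n`. -/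
def cycleLength (n : ℕ) (ω : Ω) : ℕ :=
  k net f κ x₀ C γ γ' (n + 1) ω - k net f κ x₀ C γ γ' n ω

/-- The event `Z(k_n) = i` and `Z(k_{n+1}) = j`. -/
def cycleEvent (n : ℕ) (i j : net.S0) : Set Ω :=
  {ω | ZEq net f κ x₀ C γ γ' (k net f κ x₀ C γ γ' n ω) ω i.1 ∧
    ZEq net f κ x₀ C γ γ' (k net f κ x₀ C γ γ' (n + 1) ω) ω j.1}

end Loop

end Anytime

end

/-!
The buffer lengths evolve without reference to the plant, so `Z` is a function of the network data
`(C(t+1), γ(t), γ'(t))`. This input process is a Markov chain by the cylinder law, and hence `Z` is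
one with transition matrix `transZ` (`isMarkovChain_inp`, `isMarkovChain_zProc`). Everything about
the times `k_n` then concerns visits of a finite Markov chain to the set `E` of states with an
empty actuator buffer.

*Visits.* Since `dropCA > 0`, a run of failed controller-actuator transmissions empties the
actuator buffer within a bounded number of steps with probability bounded below
(`sum_killed_pow_le_of_la_le`), so visits recur almost surely (`ae_infinite_visits`). Let `K` be
`transZ` killed on entering `E`. Then `D(l+1)` is the restriction of `K ^ l * transZ`
(`D_succ_apply`), because paths from visited states never meet unvisited ones. Splitting a cycle
according to its starting time `m` and its length `l + 1`, the Markov property gives the product of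
`P(k_n = m, Z(m) = i)` and `D(l+1) i j`; the first factor cancels in the conditional expectation
(`integral_cond_cycle`).

*Stability.* A nonempty actuator buffer followed by the controller buffer is always the plan that
the policy would make from the current state (`buffersFollowPlan_evolve`). So `V` is multiplied by
at most `ρ` in a step with nonempty actuator buffer and by at most `α` otherwise, and `V(x(t))` is
at most `ψ₂(|x(0)|)` times a product of such factors, which is independent of `x(0)`. Instead of
following the cycles one by one, the sum over `t` of the expected products is bounded by a test
function `h` with `a z * ∑ z', transZ z z' * h z' + 1 ≤ h z`, where `a z` is the factor at `z`
(`tsum_lintegral_weight_lt_top`). Such an `h` exists once the discounted returns to `E`, weighted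
by `α`, have mass less than `1` (`exists_testFunction`), and this mass is at most
`(α / ρ) ∑ⱼ r i j * Ṽ i j ≤ Ω'` (`discounted_return_le_OmegaPrime`).
-/

namespace Anytime

/-! ### Finite Markov chains and killed transition matrices -/

section KilledMatrix

variable {S : Type*}

/-- The transition matrix `Q` killed on entering `E`: its powers give the probabilities of the
paths that avoid `E` after their starting point. -/
def killed (E : S → Prop) [DecidablePred E] (Q : Matrix S S ℝ) : Matrix S S ℝ :=
  fun i j => if E j then 0 else Q i j

lemma killed_nonneg (E : S → Prop) [DecidablePred E] {Q : Matrix S S ℝ}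
    (hQ : ∀ i j, 0 ≤ Q i j) (i j : S) : 0 ≤ killed E Q i j := by
  unfold killed
  split_ifs
  · exact le_rfl
  · exact hQ i j

variable [Fintype S] [DecidableEq S]

lemma pow_apply_nonneg {A : Matrix S S ℝ} (hA : ∀ i j, 0 ≤ A i j) (n : ℕ) (i j : S) :
    0 ≤ (A ^ n) i j := by
  induction n generalizing j with
  | zero =>
    rw [pow_zero, Matrix.one_apply]
    split_ifs <;> norm_num
  | succ n ih =>
    rw [pow_succ, Matrix.mul_apply]
    exact Finset.sum_nonneg fun k _ => mul_nonneg (ih k) (hA k j)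

lemma pow_mul_rowSum_le {A : Matrix S S ℝ} (hA : ∀ i j, 0 ≤ A i j) {N : ℕ} {θ : ℝ} (hθ : 0 ≤ θ)
    (hN : ∀ i, ∑ j, (A ^ N) i j ≤ θ) (n : ℕ) (i : S) : ∑ j, (A ^ (N * n)) i j ≤ θ ^ n := by
  induction n generalizing i with
  | zero => simp [Matrix.one_apply]
  | succ n ih =>
    have h : ∀ j, (A ^ (N * (n + 1))) i j = ∑ k, (A ^ N) i k * (A ^ (N * n)) k j := fun j => by
      rw [Nat.mul_succ, add_comm, pow_add, Matrix.mul_apply]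
    simp only [h]
    rw [Finset.sum_comm]
    simp only [← Finset.mul_sum]
    calc ∑ k, (A ^ N) i k * ∑ j, (A ^ (N * n)) k j
        ≤ ∑ k, (A ^ N) i k * θ ^ n :=
          Finset.sum_le_sum fun k _ => mul_le_mul_of_nonneg_left (ih k) (pow_apply_nonneg hA _ _ _)
      _ = (∑ k, (A ^ N) i k) * θ ^ n := by rw [Finset.sum_mul]
      _ ≤ θ * θ ^ n := mul_le_mul_of_nonneg_right (hN i) (pow_nonneg hθ n)
      _ = θ ^ (n + 1) := by rw [pow_succ']

end KilledMatrix

lemma dependsOn_avoid {S : Type*} (E : S → Prop) {m : ℕ} (l : ℕ) {H : (ℕ → S) → Prop}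
    (hH : DependsOn H (Set.Iic m)) (i : S) :
    DependsOn (fun p : ℕ → S => H p ∧ p m = i ∧ ∀ s, m < s → s ≤ m + l → ¬ E (p s))
      (Set.Iic (m + l)) := by
  intro p p' h
  have e1 : H p = H p' := hH fun t ht => h t (by simp at ht ⊢; omega)
  have e2 : p m = p' m := h m (by simp)
  have e3 : ∀ s ≤ m + l, p s = p' s := fun s hs => h s hs
  simp only [e1, e2, eq_iff_iff]
  constructor
  · rintro ⟨a, b, c⟩
    exact ⟨a, b, fun s h1 h2 => e3 s h2 ▸ c s h1 h2⟩
  · rintro ⟨a, b, c⟩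
    exact ⟨a, b, fun s h1 h2 => (e3 s h2).symm ▸ c s h1 h2⟩

section FiniteChain

variable {Ω S : Type*} [MeasurableSpace Ω] {μ : Measure Ω}

/-- The first `m + 1` terms of a sequence. -/
def initSeg (m : ℕ) (p : ℕ → S) : Fin (m + 1) → S := fun t => p t

/-- A finite sequence, continued by its last term. -/
def extendSeg {m : ℕ} (w : Fin (m + 1) → S) : ℕ → S := fun t => w ⟨min t m, by omega⟩

lemma extendSeg_initSeg {m : ℕ} (p : ℕ → S) {t : ℕ} (ht : t ≤ m) :
    extendSeg (initSeg m p) t = p t := by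
  simp [extendSeg, initSeg, ht]

lemma extendSeg_apply {m : ℕ} (w : Fin (m + 1) → S) {t : ℕ} (ht : t ≤ m) :
    extendSeg w t = w ⟨t, by omega⟩ := by
  simp [extendSeg, ht]

lemma initSeg_eq_iff {m : ℕ} (p : ℕ → S) (w : Fin (m + 1) → S) :
    initSeg m p = w ↔ ∀ t ≤ m, p t = extendSeg w t := by
  constructor
  · rintro rfl t ht
    rw [extendSeg_initSeg p ht]
  · intro h
    funext t
    have := h t (by omega)
    rw [extendSeg_apply w (by omega)] at this
    exact this

lemma dependsOn_extendSeg {β : Type*} {m : ℕ} {F : (ℕ → S) → β} (hF : DependsOn F (Set.Iic m))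
    (p : ℕ → S) : F (extendSeg (initSeg m p)) = F p :=
  hF fun _ ht => extendSeg_initSeg p ht

/-- Law of total probability over the values of a finitely valued random variable. -/
lemma measureReal_eq_sum_fiber [IsFiniteMeasure μ] {T : Type*} [Fintype T] [MeasurableSpace T]
    [MeasurableSingletonClass T] {Y : Ω → T} (hY : Measurable Y) (E : Set Ω) :
    μ.real E = ∑ y, μ.real {ω | ω ∈ E ∧ Y ω = y} := by
  have h := sum_measureReal_preimage_singleton (μ := μ.restrict E) (Finset.univ : Finset T)
    (f := Y) (fun y _ => hY (measurableSet_singleton y))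
  have h2 : (μ.restrict E).real (Y ⁻¹' ((Finset.univ : Finset T) : Set T)) = μ.real E := by
    simp [measureReal_def]
  rw [h2] at h
  rw [← h]
  refine Finset.sum_congr rfl fun y _ => ?_
  rw [measureReal_restrict_apply (hY (measurableSet_singleton y))]
  congr 1
  ext ω
  simp [and_comm]

variable [MeasurableSpace S] {Z : ℕ → Ω → S}

lemma measurable_initSeg (hZ : ∀ t, Measurable (Z t)) (m : ℕ) :
    Measurable fun ω => initSeg m fun t => Z t ω :=
  measurable_pi_lambda _ fun t => hZ t

variable [Fintype S] [DiscreteMeasurableSpace S]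

lemma measurable_of_dependsOn (hZ : ∀ t, Measurable (Z t)) {β : Type*} [MeasurableSpace β]
    {m : ℕ} {F : (ℕ → S) → β} (hF : DependsOn F (Set.Iic m)) :
    Measurable fun ω => F fun t => Z t ω := by
  have : (fun ω => F fun t => Z t ω) =
      (fun w : Fin (m + 1) → S => F (extendSeg w)) ∘ fun ω => initSeg m fun t => Z t ω := by
    funext ω
    exact (dependsOn_extendSeg hF _).symm
  rw [this]
  exact (Measurable.of_discrete).comp (measurable_initSeg hZ m)

lemma measurableSet_of_dependsOn (hZ : ∀ t, Measurable (Z t)) {m : ℕ} {H : (ℕ → S) → Prop}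
    (hH : DependsOn H (Set.Iic m)) : MeasurableSet {ω | H fun t => Z t ω} :=
  measurableSet_setOfPred.2 (measurable_of_dependsOn hZ hH)

/-- The Markov property with transition matrix `Q`: given the present state, the next state is
independent of every event `H` of the past. No initial law is prescribed. -/
def IsMarkovChain (μ : Measure Ω) (Z : ℕ → Ω → S) (Q : Matrix S S ℝ) : Prop :=
  ∀ (m : ℕ) (H : (ℕ → S) → Prop), DependsOn H (Set.Iic m) → ∀ z z' : S,
    μ.real {ω | H (fun t => Z t ω) ∧ Z m ω = z ∧ Z (m + 1) ω = z'} =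
      μ.real {ω | H (fun t => Z t ω) ∧ Z m ω = z} * Q z z'

/-- A process whose finite paths have the product law of a Markov chain has the Markov
property. -/
lemma isMarkovChain_of_pathLaw [IsFiniteMeasure μ] (hZ : ∀ t, Measurable (Z t))
    {Q : Matrix S S ℝ} {init : S → ℝ}
    (hlaw : ∀ (m : ℕ) (x : ℕ → S), μ.real {ω | ∀ t ≤ m, Z t ω = x t} =
      init (x 0) * ∏ t ∈ Finset.range m, Q (x t) (x (t + 1))) :
    IsMarkovChain μ Z Q := by
  intro m H hH z z'
  rw [measureReal_eq_sum_fiber (measurable_initSeg hZ m),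
    measureReal_eq_sum_fiber (measurable_initSeg hZ m) {ω | H (fun t => Z t ω) ∧ Z m ω = z},
    Finset.sum_mul]
  refine Finset.sum_congr rfl fun w _ => ?_
  simp only [initSeg_eq_iff, Set.mem_ofPred_eq]
  have hHw : ∀ ω, (∀ t ≤ m, Z t ω = extendSeg w t) →
      (H (fun t => Z t ω) ↔ H (extendSeg w)) := fun ω hω =>
    iff_of_eq (hH fun t ht => hω t ht)
  by_cases hw : H (extendSeg w) ∧ extendSeg w m = z
  · have h1 : {ω | (H (fun t => Z t ω) ∧ Z m ω = z) ∧ ∀ t ≤ m, Z t ω = extendSeg w t} =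
        {ω | ∀ t ≤ m, Z t ω = extendSeg w t} := by
      ext ω
      simp only [Set.mem_ofPred_eq, and_iff_right_iff_imp]
      intro h
      exact ⟨(hHw ω h).2 hw.1, (h m le_rfl).trans hw.2⟩
    have h2 : {ω | (H (fun t => Z t ω) ∧ Z m ω = z ∧ Z (m + 1) ω = z') ∧
        ∀ t ≤ m, Z t ω = extendSeg w t} =
        {ω | ∀ t ≤ m + 1, Z t ω = if t ≤ m then extendSeg w t else z'} := by
      ext ω
      simp only [Set.mem_ofPred_eq]
      constructor
      · rintro ⟨⟨-, -, h⟩, h'⟩ t ht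
        split_ifs with htm
        · exact h' t htm
        · obtain rfl : t = m + 1 := by omega
          exact h
      · intro h
        have h' : ∀ t ≤ m, Z t ω = extendSeg w t := fun t ht => by
          simpa [ht] using h t (by omega)
        refine ⟨⟨(hHw ω h').2 hw.1, (h' m le_rfl).trans hw.2, ?_⟩, h'⟩
        simpa using h (m + 1) le_rfl
    rw [h1, h2, hlaw, hlaw, Finset.prod_range_succ, ← mul_assoc]
    have hprod : ∏ t ∈ Finset.range m, Q (if t ≤ m then extendSeg w t else z')
        (if t + 1 ≤ m then extendSeg w (t + 1) else z') =
        ∏ t ∈ Finset.range m, Q (extendSeg w t) (extendSeg w (t + 1)) := by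
      refine Finset.prod_congr rfl fun t ht => ?_
      have := Finset.mem_range.1 ht
      rw [if_pos (by omega), if_pos (by omega)]
    rw [hprod]
    simp [hw.2]
  · have h1 : {ω | (H (fun t => Z t ω) ∧ Z m ω = z) ∧ ∀ t ≤ m, Z t ω = extendSeg w t} = ∅ := by
      ext ω
      simp only [Set.mem_ofPred_eq, Set.mem_empty_iff_false, iff_false]
      rintro ⟨⟨h, h'⟩, h''⟩
      exact hw ⟨(hHw ω h'').1 h, (h'' m le_rfl).symm.trans h'⟩
    have h2 : {ω | (H (fun t => Z t ω) ∧ Z m ω = z ∧ Z (m + 1) ω = z') ∧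
        ∀ t ≤ m, Z t ω = extendSeg w t} = ∅ := by
      ext ω
      simp only [Set.mem_ofPred_eq, Set.mem_empty_iff_false, iff_false]
      rintro ⟨⟨h, h', -⟩, h''⟩
      exact hw ⟨(hHw ω h'').1 h, (h'' m le_rfl).symm.trans h'⟩
    rw [h1, h2]
    simp

variable [DecidableEq S] [IsProbabilityMeasure μ] {Q : Matrix S S ℝ} (E : S → Prop)
  [DecidablePred E]

/-- Probability that the chain moves from `i` to `j` in `l` steps without meeting `E`. -/
lemma IsMarkovChain.measureReal_avoid (hM : IsMarkovChain μ Z Q) (hZ : ∀ t, Measurable (Z t))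
    (m l : ℕ) {H : (ℕ → S) → Prop} (hH : DependsOn H (Set.Iic m)) (i j : S) :
    μ.real {ω | (H (fun t => Z t ω) ∧ Z m ω = i ∧
        ∀ s, m < s → s ≤ m + l → ¬ E (Z s ω)) ∧ Z (m + l) ω = j} =
      μ.real {ω | H (fun t => Z t ω) ∧ Z m ω = i} * (killed E Q ^ l) i j := by
  induction l generalizing j with
  | zero =>
    by_cases hij : i = j
    · subst hij
      simp only [pow_zero, Matrix.one_apply_eq, mul_one]
      congr 1
      ext ω
      simp only [Set.mem_ofPred_eq, Nat.add_zero]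
      constructor
      · rintro ⟨⟨h1, h2, -⟩, -⟩
        exact ⟨h1, h2⟩
      · rintro ⟨h1, h2⟩
        exact ⟨⟨h1, h2, fun s _ _ => by omega⟩, h2⟩
    · simp only [pow_zero, Matrix.one_apply_ne hij, mul_zero]
      convert measureReal_empty (μ := μ)
      ext ω
      simp only [Set.mem_ofPred_eq, Nat.add_zero, Set.mem_empty_iff_false, iff_false]
      rintro ⟨⟨-, h2, -⟩, h3⟩
      exact hij (h2.symm.trans h3)
  | succ l ih =>
    rw [pow_succ, Matrix.mul_apply, Finset.mul_sum]
    by_cases hj : E j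
    · have h0 : ∀ k, killed E Q k j = 0 := fun k => by simp [killed, hj]
      simp only [h0, mul_zero, Finset.sum_const_zero]
      convert measureReal_empty (μ := μ)
      ext ω
      simp only [Set.mem_ofPred_eq, Set.mem_empty_iff_false, iff_false]
      rintro ⟨⟨-, -, h2⟩, h3⟩
      exact h2 (m + (l + 1)) (by omega) le_rfl (h3 ▸ hj)
    · rw [measureReal_eq_sum_fiber (hZ (m + l))]
      refine Finset.sum_congr rfl fun k _ => ?_
      have hdep := dependsOn_avoid E l hH i
      have h1 := hM (m + l) _ hdep k j
      rw [ih k, mul_assoc] at h1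
      have hk : killed E Q k j = Q k j := by simp [killed, hj]
      rw [hk, ← h1]
      congr 1
      ext ω
      simp only [Set.mem_ofPred_eq, ← Nat.add_assoc]
      constructor
      · rintro ⟨⟨⟨a, b, c⟩, d⟩, e⟩
        exact ⟨⟨a, b, fun s h1 h2 => c s h1 (by omega)⟩, e, d⟩
      · rintro ⟨⟨a, b, c⟩, e, d⟩
        refine ⟨⟨⟨a, b, fun s h1 h2 => ?_⟩, d⟩, e⟩
        rcases Nat.lt_or_ge s (m + l + 1) with h | h
        · exact c s h1 (by omega)
        · obtain rfl : s = m + l + 1 := by omega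
          rwa [d]

/-- Probability of an excursion outside `E` of length `l` from `i`, followed by a step to `j`. -/
lemma IsMarkovChain.measureReal_avoid_step (hM : IsMarkovChain μ Z Q)
    (hZ : ∀ t, Measurable (Z t))
    (m l : ℕ) {H : (ℕ → S) → Prop} (hH : DependsOn H (Set.Iic m)) (i j : S) :
    μ.real {ω | (H (fun t => Z t ω) ∧ Z m ω = i ∧
        ∀ s, m < s → s ≤ m + l → ¬ E (Z s ω)) ∧ Z (m + l + 1) ω = j} =
      μ.real {ω | H (fun t => Z t ω) ∧ Z m ω = i} * (killed E Q ^ l * Q) i j := by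
  rw [Matrix.mul_apply, Finset.mul_sum, measureReal_eq_sum_fiber (hZ (m + l))]
  refine Finset.sum_congr rfl fun k _ => ?_
  have hdep := dependsOn_avoid E l hH i
  rw [← mul_assoc, ← hM.measureReal_avoid E hZ m l hH i k, ← hM (m + l) _ hdep k j]
  congr 1
  ext ω
  simp only [Set.mem_ofPred_eq]
  tauto

/-- If, from every state, the chain avoids `E` for `N` steps with probability at most `θ < 1`,
then it almost surely visits `E` infinitely often. -/
lemma IsMarkovChain.ae_infinite_visits (hM : IsMarkovChain μ Z Q) (hZ : ∀ t, Measurable (Z t))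
    (hQ : ∀ i j, 0 ≤ Q i j) {N : ℕ} {θ : ℝ} (hθ0 : 0 ≤ θ) (hθ : θ < 1)
    (hN : ∀ i, ∑ j, (killed E Q ^ N) i j ≤ θ) :
    ∀ᵐ ω ∂μ, {t | E (Z t ω)}.Infinite := by
  have hnull : ∀ m, μ.real {ω | ∀ s, m < s → ¬ E (Z s ω)} = 0 := by
    intro m
    have hle : ∀ n, μ.real {ω | ∀ s, m < s → ¬ E (Z s ω)} ≤ θ ^ n := by
      intro n
      have hT : DependsOn (fun _ : ℕ → S => True) (Set.Iic m) := fun _ _ _ => rfl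
      calc μ.real {ω | ∀ s, m < s → ¬ E (Z s ω)}
          ≤ μ.real {ω | ∀ s, m < s → s ≤ m + N * n → ¬ E (Z s ω)} :=
            measureReal_mono fun ω h s h1 _ => h s h1
        _ = ∑ j, ∑ i, μ.real {ω | True ∧ Z m ω = i} * (killed E Q ^ (N * n)) i j := by
            rw [measureReal_eq_sum_fiber (hZ (m + N * n))]
            refine Finset.sum_congr rfl fun j _ => ?_
            rw [measureReal_eq_sum_fiber (hZ m)]
            refine Finset.sum_congr rfl fun i _ => ?_
            rw [← hM.measureReal_avoid E hZ m (N * n) hT i j]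
            congr 1
            ext ω
            simp only [Set.mem_ofPred_eq]
            tauto
        _ = ∑ i, μ.real {ω | True ∧ Z m ω = i} * ∑ j, (killed E Q ^ (N * n)) i j := by
            rw [Finset.sum_comm]
            simp only [Finset.mul_sum]
        _ ≤ ∑ i, μ.real {ω | True ∧ Z m ω = i} * θ ^ n :=
            Finset.sum_le_sum fun i _ => mul_le_mul_of_nonneg_left
              (pow_mul_rowSum_le (killed_nonneg E hQ) hθ0 hN n i) measureReal_nonneg
        _ = θ ^ n := by
            rw [← Finset.sum_mul]
            have := measureReal_eq_sum_fiber (μ := μ) (hZ m) Set.univ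
            simp only [Set.mem_univ, probReal_univ] at this
            rw [← this, one_mul]
    exact le_antisymm (ge_of_tendsto' (tendsto_pow_atTop_nhds_zero_of_lt_one hθ0 hθ) hle)
      measureReal_nonneg
  have hall : ∀ᵐ ω ∂μ, ∀ m, ¬ ∀ s, m < s → ¬ E (Z s ω) := by
    rw [ae_all_iff]
    intro m
    rw [ae_iff]
    have := (measureReal_eq_zero_iff).1 (hnull m)
    simpa only [not_not] using this
  filter_upwards [hall] with ω hω
  rw [Set.infinite_iff_exists_gt]
  intro m
  have := hω m
  push Not at this
  obtain ⟨s, h1, h2⟩ := this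
  exact ⟨s, h2, h1⟩

end FiniteChain

/-! ### First returns and the law of a cycle -/

section FirstReturn

variable {S : Type*} [Fintype S] [DecidableEq S] (E : S → Prop) [DecidablePred E]
  {Q : Matrix S S ℝ}

/-- Probability that the first return to `E` from `i` happens after `l + 1` steps, at `j`. This is
the meaning for `j ∈ E`; for other `j` it is the probability of being at `j` after `l + 1` steps
that avoid `E`. -/
def firstReturn (Q : Matrix S S ℝ) (l : ℕ) (i j : S) : ℝ := (killed E Q ^ l * Q) i j

lemma firstReturn_nonneg (hQ : ∀ i j, 0 ≤ Q i j) (l : ℕ) (i j : S) : 0 ≤ firstReturn E Q l i j := by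
  rw [firstReturn, Matrix.mul_apply]
  exact Finset.sum_nonneg fun k _ =>
    mul_nonneg (pow_apply_nonneg (killed_nonneg E hQ) _ _ _) (hQ k j)

/-- The first-return probabilities are the decrements of the survival probabilities. -/
lemma sum_firstReturn (hQ1 : ∀ i, ∑ j, Q i j = 1) (l : ℕ) (i : S) :
    ∑ j with E j, firstReturn E Q l i j =
      ∑ j, (killed E Q ^ l) i j - ∑ j, (killed E Q ^ (l + 1)) i j := by
  rw [eq_sub_iff_add_eq]
  have h1 : ∑ j, (killed E Q ^ (l + 1)) i j = ∑ j with ¬ E j, firstReturn E Q l i j := by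
    rw [Finset.sum_filter]
    refine Finset.sum_congr rfl fun j _ => ?_
    rw [pow_succ, firstReturn, Matrix.mul_apply, Matrix.mul_apply]
    by_cases hj : E j <;> simp [killed, hj]
  rw [h1, Finset.sum_filter_add_sum_filter_not]
  simp only [firstReturn, Matrix.mul_apply]
  rw [Finset.sum_comm]
  simp [← Finset.mul_sum, hQ1]

lemma sum_range_sum_firstReturn_le (hQ : ∀ i j, 0 ≤ Q i j) (hQ1 : ∀ i, ∑ j, Q i j = 1) (n : ℕ)
    (i : S) : ∑ l ∈ Finset.range n, ∑ j with E j, firstReturn E Q l i j ≤ 1 := by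
  simp only [sum_firstReturn E hQ1]
  rw [Finset.sum_range_sub' fun l => ∑ j, (killed E Q ^ l) i j]
  have : 0 ≤ ∑ j, (killed E Q ^ n) i j :=
    Finset.sum_nonneg fun j _ => pow_apply_nonneg (killed_nonneg E hQ) _ _ _
  simp only [pow_zero, Matrix.one_apply, Finset.sum_ite_eq, Finset.mem_univ, if_true]
  linarith

lemma summable_firstReturn (hQ : ∀ i j, 0 ≤ Q i j) (hQ1 : ∀ i, ∑ j, Q i j = 1) (i : S) {j : S}
    (hj : E j) : Summable fun l => firstReturn E Q l i j := by
  refine summable_of_sum_range_le (c := 1) (fun l => firstReturn_nonneg E hQ l i j) fun n => ?_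
  refine le_trans (Finset.sum_le_sum fun l _ => ?_) (sum_range_sum_firstReturn_le E hQ hQ1 n i)
  exact Finset.single_le_sum (f := fun j => firstReturn E Q l i j)
    (fun k _ => firstReturn_nonneg E hQ l i k) (by simp [hj])

lemma sum_tsum_firstReturn_le (hQ : ∀ i j, 0 ≤ Q i j) (hQ1 : ∀ i, ∑ j, Q i j = 1) (i : S) :
    ∑ j with E j, ∑' l, firstReturn E Q l i j ≤ 1 := by
  rw [← Summable.tsum_finsetSum fun j hj =>
    summable_firstReturn E hQ hQ1 i (Finset.mem_filter.1 hj).2]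
  exact Real.tsum_le_of_sum_range_le
    (fun l => Finset.sum_nonneg fun j _ => firstReturn_nonneg E hQ l i j)
    fun n => sum_range_sum_firstReturn_le E hQ hQ1 n i

lemma sum_killed_pow_le (hQ : ∀ i j, 0 ≤ Q i j) (hQ1 : ∀ i, ∑ j, Q i j = 1) (l : ℕ) (i : S) :
    ∑ j, (killed E Q ^ l) i j ≤ 1 := by
  induction l with
  | zero => simp [Matrix.one_apply]
  | succ l ih =>
    have h := sum_firstReturn E hQ1 l i
    have h0 : 0 ≤ ∑ j with E j, firstReturn E Q l i j :=
      Finset.sum_nonneg fun j _ => firstReturn_nonneg E hQ l i j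
    linarith

end FirstReturn

section CycleLaw

variable {Ω S : Type*} {Z : ℕ → Ω → S} (E : S → Prop)

variable (Z) in
/-- The time of the `n`-th visit to `E`, counted from `0`. -/
noncomputable def visitTime (n : ℕ) (ω : Ω) : ℕ := Nat.nth (fun t => E (Z t ω)) n

variable (Z) in
/-- The event that the `n`-th and the `n + 1`-st visit to `E` are at `i` and at `j`. -/
def successive (n : ℕ) (i j : S) : Set Ω :=
  {ω | Z (visitTime Z E n ω) ω = i ∧ Z (visitTime Z E (n + 1) ω) ω = j}

variable [DecidablePred E]

variable (Z) in
/-- The event that the `n`-th visit to `E` happens at time `m` and in the state `i`, the next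
visit happens at time `m + l + 1` and in the state `j`; here `i, j ∈ E` is understood. -/
def visitPair (n : ℕ) (i j : S) (a : ℕ × ℕ) : Set Ω :=
  {ω | (Nat.count (fun t => E (Z t ω)) a.1 = n ∧ Z a.1 ω = i ∧
    ∀ s, a.1 < s → s ≤ a.1 + a.2 → ¬ E (Z s ω)) ∧ Z (a.1 + a.2 + 1) ω = j}

lemma dependsOn_count (m n : ℕ) :
    DependsOn (fun p : ℕ → S => Nat.count (fun t => E (p t)) m = n) (Set.Iic m) := by
  intro p p' h
  have : ∀ r ≤ m, Nat.count (fun t => E (p t)) r = Nat.count (fun t => E (p' t)) r := by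
    intro r hr
    induction r with
    | zero => simp
    | succ r ih =>
      rw [Nat.count_succ, Nat.count_succ, ih (by omega), h r (by simp; omega)]
  simp only [this m le_rfl]

lemma count_eq_of_avoid {p : ℕ → Prop} [DecidablePred p] {m l : ℕ} (hm : p m)
    (h : ∀ s, m < s → s ≤ m + l → ¬ p s) : Nat.count p (m + l + 1) = Nat.count p m + 1 := by
  induction l with
  | zero => simp [Nat.count_succ, hm]
  | succ l ih =>
    rw [← Nat.add_assoc, Nat.count_succ, ih fun s h1 h2 => h s h1 (by omega),
      if_neg (h (m + l + 1) (by omega) (by omega))]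

lemma visitTime_eq_of_mem_visitPair {n : ℕ} {i j : S} (hi : E i) (hj : E j) {a : ℕ × ℕ} {ω : Ω}
    (h : ω ∈ visitPair Z E n i j a) :
    visitTime Z E n ω = a.1 ∧ visitTime Z E (n + 1) ω = a.1 + a.2 + 1 := by
  obtain ⟨⟨h1, h2, h3⟩, h4⟩ := h
  have hm : E (Z a.1 ω) := h2 ▸ hi
  have hm' : E (Z (a.1 + a.2 + 1) ω) := h4 ▸ hj
  have hc := count_eq_of_avoid (p := fun t => E (Z t ω)) hm h3
  constructor
  · rw [← h1]
    exact Nat.nth_count (p := fun t => E (Z t ω)) hm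
  · rw [← h1, ← hc]
    exact Nat.nth_count (p := fun t => E (Z t ω)) hm'

lemma iUnion_visitPair {n : ℕ} {i j : S} (hi : E i) (hj : E j) {ω : Ω}
    (hω : {t | E (Z t ω)}.Infinite) :
    ω ∈ ⋃ a, visitPair Z E n i j a ↔
      ω ∈ successive Z E n i j := by
  rw [Set.mem_iUnion]
  constructor
  · rintro ⟨a, ha⟩
    obtain ⟨h1, h2⟩ := visitTime_eq_of_mem_visitPair E hi hj ha
    rw [successive, Set.mem_ofPred_eq, h1, h2]
    exact ⟨ha.1.2.1, ha.2⟩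
  · rintro ⟨h1, h2⟩
    unfold visitTime at h1 h2
    set p : ℕ → Prop := fun t => E (Z t ω) with hp
    have hlt : Nat.nth p n < Nat.nth p (n + 1) := (Nat.nth_lt_nth hω).2 (Nat.lt_succ_self n)
    refine ⟨(Nat.nth p n, Nat.nth p (n + 1) - Nat.nth p n - 1), ⟨⟨?_, h1, ?_⟩, ?_⟩⟩
    · exact Nat.count_nth_of_infinite hω n
    · intro s hs1 hs2 hs3
      have hs2' : s < Nat.nth p (n + 1) := by dsimp only at hs2; omega
      have hs3' : p s := hs3
      rw [← Nat.nth_count hs3'] at hs1 hs2'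
      have a1 := (Nat.nth_lt_nth hω).1 hs1
      have a2 := (Nat.nth_lt_nth hω).1 hs2'
      omega
    · have : Nat.nth p n + (Nat.nth p (n + 1) - Nat.nth p n - 1) + 1 = Nat.nth p (n + 1) := by
        omega
      dsimp only
      rw [this, h2]

lemma pairwise_disjoint_visitPair {n : ℕ} {i j : S} (hi : E i) (hj : E j) :
    Pairwise (Function.onFun Disjoint (visitPair Z E n i j)) := by
  intro a b hab
  refine Set.disjoint_left.2 fun ω ha hb => hab ?_
  obtain ⟨h1, h2⟩ := visitTime_eq_of_mem_visitPair E hi hj ha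
  obtain ⟨h3, h4⟩ := visitTime_eq_of_mem_visitPair E hi hj hb
  ext <;> omega

variable [MeasurableSpace Ω] {μ : Measure Ω} [Fintype S] [MeasurableSpace S]
  [DiscreteMeasurableSpace S]

lemma measurableSet_visitPair (hZ : ∀ t, Measurable (Z t)) (n : ℕ) (i j : S) (a : ℕ × ℕ) :
    MeasurableSet (visitPair Z E n i j a) := by
  have h1 := measurableSet_of_dependsOn hZ
    (dependsOn_avoid E a.2 (dependsOn_count E a.1 n) i)
  have h2 : MeasurableSet {ω | Z (a.1 + a.2 + 1) ω = j} :=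
    hZ (a.1 + a.2 + 1) (measurableSet_singleton j)
  exact h1.inter h2

variable [IsProbabilityMeasure μ] [DecidableEq S] {Q : Matrix S S ℝ}

lemma IsMarkovChain.measureReal_visitPair (hM : IsMarkovChain μ Z Q) (hZ : ∀ t, Measurable (Z t))
    (n : ℕ) (i j : S) (a : ℕ × ℕ) :
    μ.real (visitPair Z E n i j a) =
      μ.real {ω | Nat.count (fun t => E (Z t ω)) a.1 = n ∧ Z a.1 ω = i} *
        firstReturn E Q a.2 i j :=
  hM.measureReal_avoid_step E hZ a.1 a.2 (dependsOn_count E a.1 n) i j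

/-- Law of the length of the cycle between two successive visits to `E`, as the integral of a
bounded function `g` over the event that these visits are at `i` and at `j`. -/
lemma IsMarkovChain.hasSum_integral_cycle (hM : IsMarkovChain μ Z Q)
    (hZ : ∀ t, Measurable (Z t)) (hinf : ∀ᵐ ω ∂μ, {t | E (Z t ω)}.Infinite)
    {g : ℕ → ℝ} (hg : ∀ l, ‖g l‖ ≤ 1) (n : ℕ) {i j : S} (hi : E i) (hj : E j) :
    HasSum (fun a : ℕ × ℕ =>
      μ.real {ω | Nat.count (fun t => E (Z t ω)) a.1 = n ∧ Z a.1 ω = i} *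
        (g (a.2 + 1) * firstReturn E Q a.2 i j))
      (∫ ω in successive Z E n i j,
        g (visitTime Z E (n + 1) ω - visitTime Z E n ω) ∂μ) := by
  have hae : successive Z E n i j =ᵐ[μ] ⋃ a, visitPair Z E n i j a := by
    filter_upwards [hinf] with ω hω
    exact propext (iUnion_visitPair E hi hj hω).symm
  rw [Measure.restrict_congr_set hae]
  have hval : ∀ a, ∀ ω ∈ visitPair Z E n i j a,
      g (visitTime Z E (n + 1) ω - visitTime Z E n ω) = g (a.2 + 1) := by
    intro a ω h
    obtain ⟨h1, h2⟩ := visitTime_eq_of_mem_visitPair E hi hj h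
    rw [h1, h2]
    congr 1
    omega
  have hms := measurableSet_visitPair E hZ n i j
  have hint : IntegrableOn (fun ω =>
      g (visitTime Z E (n + 1) ω - visitTime Z E n ω))
      (⋃ a, visitPair Z E n i j a) μ := by
    refine Integrable.of_bound (C := 1) ?_ (Eventually.of_forall fun ω => hg _)
    rw [aestronglyMeasurable_iUnion_iff]
    intro a
    refine AEStronglyMeasurable.congr (f := fun _ => g (a.2 + 1)) aestronglyMeasurable_const ?_
    filter_upwards [ae_restrict_mem (hms a)] with ω hω
    exact (hval a ω hω).symm
  have hsum := hasSum_integral_iUnion hms (pairwise_disjoint_visitPair E hi hj) hint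
  rw [show (fun a : ℕ × ℕ =>
      μ.real {ω | Nat.count (fun t => E (Z t ω)) a.1 = n ∧ Z a.1 ω = i} *
        (g (a.2 + 1) * firstReturn E Q a.2 i j)) = fun a => ∫ ω in visitPair Z E n i j a,
          g (visitTime Z E (n + 1) ω - visitTime Z E n ω) ∂μ from funext fun a => ?_]
  · exact hsum
  rw [setIntegral_congr_fun (hms a) (hval a), setIntegral_const,
    hM.measureReal_visitPair E hZ, smul_eq_mul]
  ring

/-- Conditionally on two successive visits to `E` being at `i` and at `j`, a bounded function of
the cycle length has the mean given by the normalized first-return probabilities. -/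
lemma IsMarkovChain.integral_cond_cycle (hM : IsMarkovChain μ Z Q)
    (hZ : ∀ t, Measurable (Z t)) (hQ : ∀ i j, 0 ≤ Q i j) (hQ1 : ∀ i, ∑ j, Q i j = 1)
    (hinf : ∀ᵐ ω ∂μ, {t | E (Z t ω)}.Infinite)
    {g : ℕ → ℝ} (hg : ∀ l, ‖g l‖ ≤ 1) (n : ℕ) {i j : S} (hi : E i) (hj : E j)
    (hpos : μ (successive Z E n i j) ≠ 0) :
    ∫ ω, g (visitTime Z E (n + 1) ω - visitTime Z E n ω)
      ∂(cond μ (successive Z E n i j)) =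
      (∑' l, g (l + 1) * firstReturn E Q l i j) / ∑' l, firstReturn E Q l i j := by
  have hd := summable_firstReturn E hQ hQ1 i hj
  have hdg : Summable fun l => g (l + 1) * firstReturn E Q l i j := by
    refine Summable.of_norm_bounded hd fun l => ?_
    rw [norm_mul, Real.norm_of_nonneg (firstReturn_nonneg E hQ l i j)]
    exact mul_le_of_le_one_left (firstReturn_nonneg E hQ l i j) (hg _)
  have h1 := hM.hasSum_integral_cycle E hZ hinf (g := fun _ => 1) (by simp) n hi hj
  have h2 := hM.hasSum_integral_cycle E hZ hinf hg n hi hj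
  simp only [one_mul, integral_const, smul_eq_mul, mul_one, measureReal_restrict_apply_univ] at h1
  set c : ℕ → ℝ := fun m => μ.real {ω | Nat.count (fun t => E (Z t ω)) m = n ∧ Z m ω = i}
  have h1' : HasSum (fun m => c m * ∑' l, firstReturn E Q l i j) (μ.real (successive Z E n i j)) :=
    HasSum.prod_fiberwise h1 fun m => hd.hasSum.mul_left (c m)
  have h2' : HasSum (fun m => c m * ∑' l, g (l + 1) * firstReturn E Q l i j)
      (∫ ω in successive Z E n i j, g (visitTime Z E (n + 1) ω - visitTime Z E n ω) ∂μ) :=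
    HasSum.prod_fiberwise h2 fun m => hdg.hasSum.mul_left (c m)
  -- conditioning on a non-null event forces a positive return mass, by which one can divide
  have hA0 : μ.real (successive Z E n i j) ≠ 0 := by
    rw [Ne, measureReal_eq_zero_iff]
    exact hpos
  have hD : ∑' l, firstReturn E Q l i j ≠ 0 := by
    intro h0
    simp only [h0, mul_zero] at h1'
    exact hA0 (h1'.unique hasSum_zero)
  have hc : Summable c :=
    (summable_mul_right_iff hD).1 h1'.summable
  have e1 := h1'.unique (hc.hasSum.mul_right _)
  have e2 := h2'.unique (hc.hasSum.mul_right _)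
  rw [ProbabilityTheory.cond, integral_smul_measure, e2, ENNReal.toReal_inv, ← measureReal_def,
    smul_eq_mul]
  rw [e1] at hA0 ⊢
  have hc0 := left_ne_zero_of_mul hA0
  field_simp

/-- If the state `i ∈ E` is visited and `E` can next be entered at `j`, then `i` and `j` are
successive visits with positive probability. -/
lemma IsMarkovChain.exists_cycle_ne_zero (hM : IsMarkovChain μ Z Q)
    (hZ : ∀ t, Measurable (Z t)) {i j : S} (hi : E i) (hj : E j) {m l : ℕ}
    (him : μ {ω | Z m ω = i} ≠ 0) (hl : firstReturn E Q l i j ≠ 0) :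
    ∃ n, μ (successive Z E n i j) ≠ 0 := by
  have : ∃ n, μ {ω | Nat.count (fun t => E (Z t ω)) m = n ∧ Z m ω = i} ≠ 0 := by
    by_contra! h
    refine him (measure_mono_null (t := ⋃ n,
      {ω | Nat.count (fun t => E (Z t ω)) m = n ∧ Z m ω = i}) ?_ (measure_iUnion_null h))
    intro ω hω
    simpa using hω
  obtain ⟨n, hn⟩ := this
  -- the time `m` is the `n`-th visit with positive probability
  refine ⟨n, fun h0 => ?_⟩
  have h1 : μ (visitPair Z E n i j (m, l)) = 0 := by
    refine measure_mono_null ?_ h0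
    intro ω hω
    obtain ⟨h1, h2⟩ := visitTime_eq_of_mem_visitPair E hi hj hω
    rw [successive, Set.mem_ofPred_eq, h1, h2]
    exact ⟨hω.1.2.1, hω.2⟩
  have h2 := hM.measureReal_visitPair E hZ n i j (m, l)
  rw [measureReal_def, h1, ENNReal.toReal_zero] at h2
  rcases mul_eq_zero.1 h2.symm with h | h
  · exact hn ((measureReal_eq_zero_iff).1 h)
  · exact hl h

end CycleLaw

/-! ### Expected total weight of a Markov chain -/

section Potential

variable {Ω S : Type*}

/-- The weight accumulated before time `t`: one factor `a (p s)` for each `s < t`, with negative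
values of `a` counted as `0`. -/
noncomputable def weight (a : S → ℝ) (p : ℕ → S) (t : ℕ) : ℝ≥0∞ :=
  ∏ s ∈ Finset.range t, ENNReal.ofReal (a (p s))

lemma dependsOn_weight (a : S → ℝ) (t : ℕ) :
    DependsOn (fun p => weight a p t) (Set.Iic t) := by
  intro p p' h
  refine Finset.prod_congr rfl fun s hs => ?_
  rw [h s (Finset.mem_range.1 hs).le]

variable [MeasurableSpace Ω] {μ : Measure Ω}

lemma setLIntegral_eq_sum_fiber {T : Type*} [Fintype T] [MeasurableSpace T]
    [MeasurableSingletonClass T] {Y : Ω → T} (hY : Measurable Y) {A : Set Ω}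
    (hA : MeasurableSet A) (F : Ω → ℝ≥0∞) :
    ∫⁻ ω in A, F ω ∂μ = ∑ y, ∫⁻ ω in {ω | Y ω = y ∧ ω ∈ A}, F ω ∂μ := by
  have hm : ∀ y, MeasurableSet {ω | Y ω = y ∧ ω ∈ A} := fun y =>
    (hY (measurableSet_singleton y)).inter hA
  rw [← tsum_fintype (L := .unconditional _), ← lintegral_iUnion hm]
  · congr 2
    ext ω
    simp
  · intro y y' hyy
    refine Set.disjoint_left.2 fun ω h h' => hyy ?_
    exact h.1.symm.trans h'.1

variable [Fintype S] [MeasurableSpace S] [DiscreteMeasurableSpace S] {Z : ℕ → Ω → S}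

lemma setLIntegral_of_dependsOn (hZ : ∀ t, Measurable (Z t)) {m : ℕ} {F : (ℕ → S) → ℝ≥0∞}
    (hF : DependsOn F (Set.Iic m)) (A : Set Ω) :
    ∫⁻ ω in A, F (fun t => Z t ω) ∂μ =
      ∑ w : Fin (m + 1) → S, F (extendSeg w) *
        μ {ω | (∀ t ≤ m, Z t ω = extendSeg w t) ∧ ω ∈ A} := by
  have h1 : ∫⁻ ω in A, F (fun t => Z t ω) ∂μ =
      ∫⁻ w : Fin (m + 1) → S, F (extendSeg w)
        ∂((μ.restrict A).map fun ω => initSeg m fun t => Z t ω) := by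
    rw [lintegral_map .of_discrete (measurable_initSeg hZ m)]
    exact lintegral_congr fun ω => (dependsOn_extendSeg hF _).symm
  rw [h1, lintegral_fintype]
  refine Finset.sum_congr rfl fun w _ => ?_
  rw [Measure.map_apply (measurable_initSeg hZ m) (measurableSet_singleton w),
    Measure.restrict_apply (measurable_initSeg hZ m (measurableSet_singleton w))]
  congr 2
  ext ω
  simp [initSeg_eq_iff]

variable [IsProbabilityMeasure μ]

/-- The Markov property for nonnegative functionals of the past. -/
lemma IsMarkovChain.setLIntegral_step {Q : Matrix S S ℝ} (hM : IsMarkovChain μ Z Q)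
    (hZ : ∀ t, Measurable (Z t)) {m : ℕ} {F : (ℕ → S) → ℝ≥0∞}
    (hF : DependsOn F (Set.Iic m)) (z z' : S) :
    ∫⁻ ω in {ω | Z m ω = z ∧ Z (m + 1) ω = z'}, F (fun t => Z t ω) ∂μ =
      ENNReal.ofReal (Q z z') * ∫⁻ ω in {ω | Z m ω = z}, F (fun t => Z t ω) ∂μ := by
  rw [setLIntegral_of_dependsOn hZ hF, setLIntegral_of_dependsOn hZ hF, Finset.mul_sum]
  refine Finset.sum_congr rfl fun w _ => ?_
  have hdep : DependsOn (fun p : ℕ → S => ∀ t ≤ m, p t = extendSeg w t) (Set.Iic m) := by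
    intro p p' h
    simp only [eq_iff_iff]
    exact forall₂_congr fun t ht => by rw [h t ht]
  have h := hM m _ hdep z z'
  have h' : μ {ω | (∀ t ≤ m, Z t ω = extendSeg w t) ∧ ω ∈ {ω | Z m ω = z ∧ Z (m + 1) ω = z'}} =
      μ {ω | (∀ t ≤ m, Z t ω = extendSeg w t) ∧ ω ∈ {ω | Z m ω = z}} *
        ENNReal.ofReal (Q z z') := by
    simp only [Set.mem_ofPred_eq]
    rw [← ofReal_measureReal (μ := μ)
      (s := {ω | (∀ t ≤ m, Z t ω = extendSeg w t) ∧ Z m ω = z ∧ Z (m + 1) ω = z'}), h,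
      ENNReal.ofReal_mul measureReal_nonneg, ofReal_measureReal]
  rw [h']
  ring

/-- Test-function bound for the total expected weight: `h` decreases by at least `1` on average in
each weighted step from a reachable state. -/
lemma IsMarkovChain.tsum_lintegral_weight_lt_top {Q : Matrix S S ℝ} (hM : IsMarkovChain μ Z Q)
    (hZ : ∀ t, Measurable (Z t)) (hQ : ∀ i j, 0 ≤ Q i j) {a h : S → ℝ} (ha : ∀ z, 0 ≤ a z)
    (hh : ∀ z, 0 ≤ h z) {R : S → Prop} (hR0 : ∀ z, ¬ R z → μ {ω | Z 0 ω = z} = 0)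
    (hR : ∀ z z', R z → 0 < Q z z' → R z')
    (hdrift : ∀ z, R z → a z * ∑ z', Q z z' * h z' + 1 ≤ h z) :
    ∑' t, ∫⁻ ω, weight a (fun s => Z s ω) t ∂μ < ∞ := by
  set ε : ℕ → S → ℝ≥0∞ := fun t z =>
    ∫⁻ ω in {ω | Z t ω = z}, weight a (fun s => Z s ω) t ∂μ with hε
  have htot : ∀ t, ∫⁻ ω, weight a (fun s => Z s ω) t ∂μ = ∑ z, ε t z := by
    intro t
    rw [← setLIntegral_univ, setLIntegral_eq_sum_fiber (hZ t) MeasurableSet.univ]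
    simp [hε]
  have hstep : ∀ t z', ε (t + 1) z' =
      ∑ z, ENNReal.ofReal (a z * Q z z') * ε t z := by
    intro t z'
    rw [hε]
    dsimp only
    have hA : MeasurableSet {ω | Z (t + 1) ω = z'} := hZ (t + 1) (measurableSet_singleton z')
    rw [setLIntegral_eq_sum_fiber (hZ t) hA]
    refine Finset.sum_congr rfl fun z _ => ?_
    have hm : MeasurableSet {ω | Z t ω = z ∧ Z (t + 1) ω = z'} :=
      (hZ t (measurableSet_singleton z)).inter (hZ (t + 1) (measurableSet_singleton z'))
    have hw : ∀ ω ∈ {ω | Z t ω = z ∧ Z (t + 1) ω = z'},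
        weight a (fun s => Z s ω) (t + 1) =
          ENNReal.ofReal (a z) * weight a (fun s => Z s ω) t := by
      intro ω hω
      rw [weight, Finset.prod_range_succ, hω.1, mul_comm]
      rfl
    have hmeas : Measurable fun ω => weight a (fun s => Z s ω) t :=
      measurable_of_dependsOn hZ (dependsOn_weight a t)
    calc ∫⁻ ω in {ω | Z t ω = z ∧ Z (t + 1) ω = z'}, weight a (fun s => Z s ω) (t + 1) ∂μ
        = ∫⁻ ω in {ω | Z t ω = z ∧ Z (t + 1) ω = z'},
            ENNReal.ofReal (a z) * weight a (fun s => Z s ω) t ∂μ := setLIntegral_congr_fun hm hw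
      _ = ENNReal.ofReal (a z) * (ENNReal.ofReal (Q z z') * ε t z) := by
          rw [lintegral_const_mul _ hmeas, hM.setLIntegral_step hZ (dependsOn_weight a t)]
      _ = ENNReal.ofReal (a z * Q z z') * ε t z := by
          rw [ENNReal.ofReal_mul (ha z), mul_assoc]
  have hreach : ∀ t z, ¬ R z → ε t z = 0 := by
    intro t
    induction t with
    | zero =>
      intro z hz
      exact setLIntegral_measure_zero _ _ (hR0 z hz)
    | succ t ih =>
      intro z' hz'
      rw [hstep]
      refine Finset.sum_eq_zero fun z _ => ?_
      by_cases hz : R z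
      · have : Q z z' = 0 :=
          le_antisymm (not_lt.1 fun hlt => hz' (hR z z' hz hlt)) (hQ z z')
        simp [this]
      · rw [ih z hz, mul_zero]
  set P : ℕ → ℝ≥0∞ := fun t => ∑ z, ENNReal.ofReal (h z) * ε t z with hP
  have hdec : ∀ t, P (t + 1) + ∑ z, ε t z ≤ P t := by
    intro t
    have h1 : P (t + 1) = ∑ z, ENNReal.ofReal (a z * ∑ z', Q z z' * h z') * ε t z := by
      rw [hP]
      simp only [hstep, Finset.mul_sum]
      rw [Finset.sum_comm]
      refine Finset.sum_congr rfl fun z _ => ?_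
      rw [ENNReal.ofReal_sum_of_nonneg fun z' _ =>
        mul_nonneg (ha z) (mul_nonneg (hQ z z') (hh z')), Finset.sum_mul]
      refine Finset.sum_congr rfl fun z' _ => ?_
      rw [← mul_assoc, ← ENNReal.ofReal_mul (hh z')]
      congr 2
      ring
    rw [h1, ← Finset.sum_add_distrib]
    refine Finset.sum_le_sum fun z _ => ?_
    by_cases hz : R z
    · calc ENNReal.ofReal (a z * ∑ z', Q z z' * h z') * ε t z + ε t z
          = (ENNReal.ofReal (a z * ∑ z', Q z z' * h z') + ENNReal.ofReal 1) * ε t z := by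
            rw [ENNReal.ofReal_one, add_mul, one_mul]
        _ = ENNReal.ofReal (a z * ∑ z', Q z z' * h z' + 1) * ε t z := by
            rw [ENNReal.ofReal_add (mul_nonneg (ha z) (Finset.sum_nonneg fun z' _ =>
              mul_nonneg (hQ z z') (hh z'))) zero_le_one]
        _ ≤ ENNReal.ofReal (h z) * ε t z := by
            gcongr
            exact hdrift z hz
    · simp [hreach t z hz]
  have hsum : ∀ n, P n + ∑ t ∈ Finset.range n, ∑ z, ε t z ≤ P 0 := by
    intro n
    induction n with
    | zero => simp
    | succ n ih =>
      rw [Finset.sum_range_succ, add_comm (∑ t ∈ Finset.range n, _), ← add_assoc]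
      exact le_trans (add_le_add_left (hdec n) _) ih
  simp only [htot]
  refine lt_of_le_of_lt (ENNReal.tsum_le_of_sum_range_le fun n =>
    le_trans le_add_self (hsum n)) ?_
  refine ENNReal.sum_lt_top.2 fun z _ => ENNReal.mul_lt_top ENNReal.ofReal_lt_top ?_
  have : ε 0 z = μ {ω | Z 0 ω = z} := by simp [hε, weight]
  rw [this]
  exact measure_lt_top μ _

end Potential

section TestFunction

variable {S : Type*} [Fintype S] [DecidableEq S] (E : S → Prop) [DecidablePred E]
  {Q : Matrix S S ℝ}

/-- A test function for the weights `α` on `E` and `ρ < 1` off `E`, when the discounted returns to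
`E` from reachable states of `E` have weight at most `θ < 1`: a large constant on `E`, and off `E`
the discounted cost of reaching `E`. -/
lemma exists_testFunction (hQ : ∀ i j, 0 ≤ Q i j) (hQ1 : ∀ i, ∑ j, Q i j = 1) {ρ α θ : ℝ}
    (hρ0 : 0 < ρ) (hρ1 : ρ < 1) (hα : 0 < α) (hθ : θ < 1) {R : S → Prop}
    (hret : ∀ i, R i → E i → α * ∑' l, ρ ^ l * ∑ j with E j, firstReturn E Q l i j ≤ θ) :
    ∃ h : S → ℝ, (∀ z, 0 ≤ h z) ∧
      ∀ z, R z → (if E z then α else ρ) * ∑ z', Q z z' * h z' + 1 ≤ h z := by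
  set f : ℕ → S → ℝ := fun l z => ∑ j with E j, firstReturn E Q l z j with hf
  set s : ℕ → S → ℝ := fun l z => ∑ j, (killed E Q ^ l) z j with hs
  have hs0 : ∀ l z, 0 ≤ s l z := fun l z =>
    Finset.sum_nonneg fun j _ => pow_apply_nonneg (killed_nonneg E hQ) _ _ _
  have hs1 : ∀ l z, s l z ≤ 1 := fun l z => sum_killed_pow_le E hQ hQ1 l z
  have hfs : ∀ l z, f l z = s l z - s (l + 1) z := fun l z => sum_firstReturn E hQ1 l z
  have hf0 : ∀ l z, 0 ≤ f l z := fun l z =>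
    Finset.sum_nonneg fun j _ => firstReturn_nonneg E hQ l z j
  have hf1 : ∀ l z, f l z ≤ 1 := fun l z => by
    have := hfs l z
    have := hs1 l z
    have := hs0 (l + 1) z
    linarith
  have hgeo : Summable fun l => ρ ^ l := summable_geometric_of_lt_one hρ0.le hρ1
  have hsummable : ∀ u : ℕ → ℝ, (∀ l, 0 ≤ u l) → (∀ l, u l ≤ 1) → Summable fun l => ρ ^ l * u l :=
    fun u hu0 hu1 => Summable.of_nonneg_of_le (fun l => mul_nonneg (pow_nonneg hρ0.le l) (hu0 l))
      (fun l => mul_le_of_le_one_right (pow_nonneg hρ0.le l) (hu1 l)) hgeo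
  have hsf := fun z => hsummable (fun l => f l z) (fun l => hf0 l z) (fun l => hf1 l z)
  have hss := fun z => hsummable (fun l => s (l + 1) z) (fun l => hs0 _ z) (fun l => hs1 _ z)
  -- large enough to absorb the cost `α / (1 - ρ)` of the excursions between returns
  obtain ⟨c, hc0, hc⟩ : ∃ c : ℝ, 0 ≤ c ∧ c * θ + α * (1 - ρ)⁻¹ + 1 ≤ c := by
    have h1 : 0 < 1 - θ := by linarith
    have h2 : 0 < (1 - ρ)⁻¹ := inv_pos.2 (by linarith)
    refine ⟨(α * (1 - ρ)⁻¹ + 1) / (1 - θ), by positivity, le_of_eq ?_⟩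
    field_simp
    ring
  set b : S → ℝ := fun z => ∑' l, ρ ^ l * (c * f l z + s (l + 1) z) with hb
  have hsb : ∀ z, Summable fun l => ρ ^ l * (c * f l z + s (l + 1) z) := fun z => by
    refine (((hsf z).mul_left c).add (hss z)).congr fun l => ?_
    ring
  have hb0 : ∀ z, 0 ≤ b z := fun z => tsum_nonneg fun l =>
    mul_nonneg (pow_nonneg hρ0.le l) (add_nonneg (mul_nonneg hc0 (hf0 l z)) (hs0 _ z))
  have hsstep : ∀ l z, ∑ z', killed E Q z z' * s l z' = s (l + 1) z := by
    intro l z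
    simp only [hs, Finset.mul_sum, pow_succ', Matrix.mul_apply]
    rw [Finset.sum_comm]
  have hfstep : ∀ l z, ∑ z', killed E Q z z' * f l z' = f (l + 1) z := by
    intro l z
    simp only [hfs, mul_sub, Finset.sum_sub_distrib, hsstep]
  -- `b` is the one-step mean of the test function
  have hmean : ∀ z, ∑ z', Q z z' * (if E z' then c else 1 + ρ * b z') = b z := by
    intro z
    have h1 : ∀ z', Q z z' * (if E z' then c else 1 + ρ * b z') =
        c * (if E z' then Q z z' else 0) + killed E Q z z' + ρ * (killed E Q z z' * b z') := by
      intro z'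
      unfold killed
      split_ifs <;> ring
    have h2 : ∑ z', (if E z' then Q z z' else 0) = f 0 z := by
      simp [hf, firstReturn, Finset.sum_filter]
    have h3 : ∑ z', killed E Q z z' = s 1 z := by simp [hs]
    have h4 : ∑ z', killed E Q z z' * b z' =
        ∑' l, ρ ^ l * (c * f (l + 1) z + s (l + 2) z) := by
      simp only [hb, ← tsum_mul_left]
      rw [← Summable.tsum_finsetSum fun z' _ => (hsb z').mul_left _]
      refine tsum_congr fun l => ?_
      rw [← hfstep, ← hsstep (l + 1), Finset.mul_sum, ← Finset.sum_add_distrib, Finset.mul_sum]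
      refine Finset.sum_congr rfl fun z' _ => ?_
      ring
    simp only [h1]
    rw [Finset.sum_add_distrib, Finset.sum_add_distrib, ← Finset.mul_sum, ← Finset.mul_sum, h2, h3,
      h4, hb]
    dsimp only
    rw [(hsb z).tsum_eq_zero_add, ← tsum_mul_left]
    simp only [pow_zero, one_mul, zero_add]
    congr 1
    refine tsum_congr fun l => ?_
    rw [pow_succ]
    ring
  refine ⟨fun z => if E z then c else 1 + ρ * b z, fun z => ?_, fun z hz => ?_⟩
  · have := hb0 z
    dsimp only
    split_ifs
    · exact hc0
    · positivity
  · dsimp only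
    rw [hmean]
    split_ifs with hE
    · have h1 : b z = c * ∑' l, ρ ^ l * f l z + ∑' l, ρ ^ l * s (l + 1) z := by
        rw [← tsum_mul_left, ← ((hsf z).mul_left c).tsum_add (hss z)]
        refine tsum_congr fun l => ?_
        ring
      have h2 : ∑' l, ρ ^ l * s (l + 1) z ≤ (1 - ρ)⁻¹ := by
        rw [← tsum_geometric_of_lt_one hρ0.le hρ1]
        exact (hss z).tsum_le_tsum
          (fun l => mul_le_of_le_one_right (pow_nonneg hρ0.le l) (hs1 _ z)) hgeo
      have h3 := mul_le_mul_of_nonneg_left (hret z hz hE) hc0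
      have h4 := mul_le_mul_of_nonneg_left h2 hα.le
      rw [h1]
      linarith
    · linarith

end TestFunction

/-! ### The chain `Z` driven by the network -/

namespace Network

variable {net : Network}

lemma outcomeProb_nonneg {q : ℝ} (h0 : 0 ≤ q) (h1 : q ≤ 1) (b : Bool) : 0 ≤ outcomeProb q b := by
  unfold outcomeProb
  split_ifs <;> linarith

lemma sum_outcomeProb (q : ℝ) : ∑ b, outcomeProb q b = 1 := by
  simp [outcomeProb]

lemma P_nonneg (c c' : net.Chan) : 0 ≤ net.P c c' :=
  (Matrix.mem_rowStochastic.1 net.P_stochastic).1 c c'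

lemma sum_P (c : net.Chan) : ∑ c', net.P c c' = 1 := by
  have h := congrFun (Matrix.mem_rowStochastic.1 net.P_stochastic).2 c
  simpa [Matrix.mulVec, dotProduct] using h

variable (net) in
/-- The values of `(C(t+1), γ(t), γ'(t))`. Pairing the outcomes at time `t` with the joint state
at time `t + 1` makes `Z(t)` a function of the values up to time `t`. -/
abbrev Inp : Type := net.Chan × Bool × Bool

/-- Probability of the next value `x` of `(C(t+1), γ(t), γ'(t))` when `C(t) = c`. -/
def inpProb (c : net.Chan) (x : net.Inp) : ℝ :=
  net.P c x.1 * outcomeProb net.dropCA x.2.1 * outcomeProb (dropSC c) x.2.2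

lemma inpProb_nonneg (c : net.Chan) (x : net.Inp) : 0 ≤ inpProb c x :=
  mul_nonneg (mul_nonneg (P_nonneg _ _)
    (outcomeProb_nonneg net.dropCA_pos.le net.dropCA_le_one _))
    (outcomeProb_nonneg (net.dropOfGain_nonneg _) (net.dropOfGain_le_one _) _)

lemma sum_inpProb_mul (c : net.Chan) (φ : Bool → ℝ) :
    ∑ x, inpProb c x * φ x.2.1 = ∑ b, outcomeProb net.dropCA b * φ b := by
  have h : ∀ (c' : net.Chan) (b : Bool),
      ∑ b', net.P c c' * outcomeProb net.dropCA b * outcomeProb (dropSC c) b' * φ b =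
        net.P c c' * (outcomeProb net.dropCA b * φ b) := by
    intro c' b
    rw [← Finset.sum_mul, ← Finset.mul_sum, sum_outcomeProb]
    ring
  rw [Fintype.sum_prod_type]
  simp only [inpProb, Fintype.sum_prod_type (α₁ := Bool), h, ← Finset.mul_sum]
  rw [← Finset.sum_mul, sum_P, one_mul]

lemma sum_inpProb (c : net.Chan) : ∑ x, inpProb c x = 1 := by
  have := sum_inpProb_mul c fun _ => 1
  simpa only [mul_one, sum_outcomeProb] using this

lemma nextLc_lt (lc : Fin (net.Λc + 1)) (la : ℕ) (c : net.Chan) (g g' : Bool) :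
    net.nextLc lc la c g g' < net.Λc + 1 := by
  have h1 : Nof c ≤ net.Λc := le_trans (Nat.lt_succ_iff.1 c.2.2.2) net.Nmax_le
  have h2 := lc.2
  unfold nextLc
  split_ifs <;> omega

lemma nextLa_lt (lc : ℕ) (la : Fin (net.Λa + 1)) (c : net.Chan) (g g' : Bool) :
    net.nextLa lc la c g g' < net.Λa + 1 := by
  have h2 := la.2
  unfold nextLa numSent
  split_ifs <;> omega

/-- One step of `Z`, driven by `x = (C(t+2), γ(t+1), γ'(t+1))`. -/
def zStep (z : net.ZState) (x : net.Inp) : net.ZState :=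
  (⟨net.nextLc z.1 z.2.1 z.2.2 x.2.1 x.2.2, nextLc_lt _ _ _ _ _⟩,
    ⟨net.nextLa z.1 z.2.1 z.2.2 x.2.1 x.2.2, nextLa_lt _ _ _ _ _⟩, x.1)

/-- The path of `Z` as a function of the path of `(C(t+1), γ(t), γ'(t))`. -/
def zPath (x : ℕ → net.Inp) : ℕ → net.ZState
  | 0 => (0, 0, (x 0).1)
  | t + 1 => zStep (zPath x t) (x (t + 1))

lemma zPath_chan (x : ℕ → net.Inp) (t : ℕ) : (zPath x t).2.2 = (x t).1 := by
  cases t <;> rfl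

lemma dependsOn_zPath (m : ℕ) : DependsOn (fun x : ℕ → net.Inp => zPath x m) (Set.Iic m) := by
  induction m with
  | zero =>
    intro x x' h
    simp [zPath, h 0]
  | succ m ih =>
    intro x x' h
    have h1 : zPath x m = zPath x' m := ih fun t ht => h t (Nat.le_succ_of_le ht)
    simp only [zPath, h1, h (m + 1) (by simp)]

lemma transZ_eq (z z' : net.ZState) :
    net.transZ z z' = ∑ x, if zStep z x = z' then inpProb z.2.2 x else 0 := by
  have h : ∀ (c : net.Chan) (g g' : Bool), zStep z (c, g, g') = z' ↔ c = z'.2.2 ∧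
      (net.nextLc z.1 z.2.1 z.2.2 g g' = z'.1 ∧ net.nextLa z.1 z.2.1 z.2.2 g g' = z'.2.1) := by
    intro c g g'
    simp only [zStep, Prod.ext_iff, Fin.ext_iff]
    tauto
  rw [Fintype.sum_prod_type, Finset.sum_eq_single z'.2.2]
  · simp only [h, true_and, Fintype.sum_prod_type]
    rw [transZ, Finset.mul_sum]
    refine Finset.sum_congr rfl fun g _ => ?_
    rw [Finset.mul_sum]
    refine Finset.sum_congr rfl fun g' _ => ?_
    rw [mul_ite, mul_zero]
    refine if_congr Iff.rfl ?_ rfl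
    simp only [inpProb]
    ring
  · intro c _ hc
    refine Finset.sum_eq_zero fun y _ => ?_
    rw [if_neg]
    rw [h c y.1 y.2]
    exact fun h' => hc h'.1
  · simp

lemma sum_transZ_mul (z : net.ZState) (φ : net.ZState → ℝ) :
    ∑ z', net.transZ z z' * φ z' = ∑ x, inpProb z.2.2 x * φ (zStep z x) := by
  simp only [transZ_eq, Finset.sum_mul]
  rw [Finset.sum_comm]
  refine Finset.sum_congr rfl fun x _ => ?_
  rw [Finset.sum_eq_single (zStep z x)]
  · simp
  · intro z' _ hz'
    rw [if_neg (Ne.symm hz'), zero_mul]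
  · simp

lemma transZ_nonneg (z z' : net.ZState) : 0 ≤ net.transZ z z' := by
  rw [transZ_eq]
  refine Finset.sum_nonneg fun x _ => ?_
  split_ifs
  · exact inpProb_nonneg _ _
  · exact le_rfl

lemma sum_transZ (z : net.ZState) : ∑ z', net.transZ z z' = 1 := by
  have := sum_transZ_mul z fun _ => 1
  simpa only [mul_one, sum_inpProb] using this

/-- The states of `Z` with an empty actuator buffer. -/
abbrev AEmpty (z : net.ZState) : Prop := z.2.1 = 0

/-- While controller-actuator transmissions fail, the actuator buffer drains by one entry per
step; hence it empties within `n + 1` steps with probability at least `dropCA ^ (n + 1)`. -/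
lemma sum_killed_pow_le_of_la_le (n : ℕ) (z : net.ZState) (hz : (z.2.1 : ℕ) ≤ n + 1) :
    ∑ j, (killed AEmpty net.transZ ^ (n + 1)) z j ≤ 1 - net.dropCA ^ (n + 1) := by
  have hq0 := net.dropCA_pos
  have hstep : ∀ (n : ℕ) (z : net.ZState), ∑ j, (killed AEmpty net.transZ ^ (n + 1)) z j =
      ∑ x, inpProb z.2.2 x * (if AEmpty (zStep z x) then 0 else
        ∑ j, (killed AEmpty net.transZ ^ n) (zStep z x) j) := by
    intro n z
    rw [← sum_transZ_mul z fun z' => if AEmpty z' then 0 else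
      ∑ j, (killed AEmpty net.transZ ^ n) z' j]
    simp only [pow_succ', Matrix.mul_apply]
    rw [Finset.sum_comm]
    refine Finset.sum_congr rfl fun k _ => ?_
    unfold killed
    split_ifs <;> simp [Finset.mul_sum]
  have hla : ∀ (z : net.ZState) (x : net.Inp), x.2.1 = false →
      ((zStep z x).2.1 : ℕ) = (z.2.1 : ℕ) - 1 := by
    intro z x hx
    simp [zStep, nextLa, hx]
  have aux : ∀ (n : ℕ), (∀ z : net.ZState, (z.2.1 : ℕ) ≤ n →
      (if AEmpty z then 0 else ∑ j, (killed AEmpty net.transZ ^ n) z j) ≤ 1 - net.dropCA ^ n) →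
      ∀ z : net.ZState, (z.2.1 : ℕ) ≤ n + 1 →
        ∑ j, (killed AEmpty net.transZ ^ (n + 1)) z j ≤ 1 - net.dropCA ^ (n + 1) := by
    intro n ih z hz
    rw [hstep]
    calc ∑ x, inpProb z.2.2 x * (if AEmpty (zStep z x) then 0 else
          ∑ j, (killed AEmpty net.transZ ^ n) (zStep z x) j)
        ≤ ∑ x : net.Inp, inpProb z.2.2 x * (if x.2.1 = false then 1 - net.dropCA ^ n else 1) := by
          refine Finset.sum_le_sum fun x _ => mul_le_mul_of_nonneg_left ?_ (inpProb_nonneg _ _)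
          split_ifs with h1 h2 h2
          · exact sub_nonneg.2 (pow_le_one₀ hq0.le net.dropCA_le_one)
          · exact zero_le_one
          · have h3 := ih (zStep z x) (by rw [hla z x h2]; omega)
            rwa [if_neg h1] at h3
          · exact sum_killed_pow_le AEmpty transZ_nonneg sum_transZ n _
      _ = 1 - net.dropCA ^ (n + 1) := by
          rw [sum_inpProb_mul z.2.2 fun b => if b = false then 1 - net.dropCA ^ n else 1]
          simp [outcomeProb]
          ring
  have hall : ∀ (n : ℕ) (z : net.ZState), (z.2.1 : ℕ) ≤ n →
      (if AEmpty z then 0 else ∑ j, (killed AEmpty net.transZ ^ n) z j) ≤ 1 - net.dropCA ^ n := by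
    intro n
    induction n with
    | zero =>
      intro z hz
      have : AEmpty z := Fin.ext (by simpa using hz)
      simp only [if_pos this, pow_zero, sub_self, le_refl]
    | succ n ih =>
      intro z hz
      split_ifs
      · exact sub_nonneg.2 (pow_le_one₀ hq0.le net.dropCA_le_one)
      · exact aux n ih z hz
  exact aux n (hall n) z hz

lemma Visited.step {z z' : net.ZState} (h : net.Visited z) (hz : 0 < net.transZ z z') :
    net.Visited z' := by
  obtain ⟨c, t, hc, ht⟩ := h
  refine ⟨c, t + 1, hc, ?_⟩
  rw [pow_succ, Matrix.mul_apply]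
  exact lt_of_lt_of_le (mul_pos ht hz) (Finset.single_le_sum
    (f := fun k => (net.transZ ^ t) (0, 0, c) k * net.transZ k z')
    (fun k _ => mul_nonneg (pow_apply_nonneg transZ_nonneg _ _ _) (transZ_nonneg _ _))
    (Finset.mem_univ z))

lemma visited_of_killed_pow_ne_zero {i : net.ZState} (hi : net.Visited i) (l : ℕ)
    {z : net.ZState} (hz : (killed AEmpty net.transZ ^ l) i z ≠ 0) : net.Visited z := by
  induction l generalizing z with
  | zero =>
    rw [pow_zero, Matrix.one_apply] at hz
    by_cases h : i = z
    · exact h ▸ hi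
    · simp [h] at hz
  | succ l ih =>
    rw [pow_succ, Matrix.mul_apply] at hz
    obtain ⟨k, -, hk⟩ := Finset.exists_ne_zero_of_sum_ne_zero hz
    refine (ih (left_ne_zero_of_mul hk)).step
      (lt_of_le_of_ne (transZ_nonneg _ _) (Ne.symm ?_))
    have := right_ne_zero_of_mul hk
    unfold killed at this
    split_ifs at this with h
    · exact absurd rfl this
    · exact this

lemma visited_of_firstReturn_ne_zero {i : net.ZState} (hi : net.Visited i) {l : ℕ}
    {z : net.ZState} (hz : firstReturn AEmpty net.transZ l i z ≠ 0) : net.Visited z := by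
  rw [firstReturn, Matrix.mul_apply] at hz
  obtain ⟨k, -, hk⟩ := Finset.exists_ne_zero_of_sum_ne_zero hz
  exact (visited_of_killed_pow_ne_zero hi l (left_ne_zero_of_mul hk)).step
    (lt_of_le_of_ne (transZ_nonneg _ _) (right_ne_zero_of_mul hk).symm)

lemma killed_pow_eq_zero_of_not_in1 {i : net.ZState} (hi : net.Visited i) (l : ℕ)
    {z : net.ZState} (hz : ¬ net.In1 z) : (killed AEmpty net.transZ ^ (l + 1)) i z = 0 := by
  by_cases hE : AEmpty z
  · rw [pow_succ, Matrix.mul_apply]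
    exact Finset.sum_eq_zero fun k _ => by simp [killed, hE]
  · by_contra h
    exact hz ⟨visited_of_killed_pow_ne_zero hi _ h, hE⟩

lemma V01_mul_V11_pow (l : ℕ) (i : net.S0) (k : net.S1) :
    (net.V01 * net.V11 ^ l) i k = (killed AEmpty net.transZ ^ (l + 1)) i.1 k.1 := by
  induction l generalizing k with
  | zero =>
    rw [pow_zero, Matrix.mul_one, zero_add, pow_one]
    simp [V01, Matrix.toBlock_apply, killed, k.2.2]
  | succ l ih =>
    rw [pow_succ, ← Matrix.mul_assoc, Matrix.mul_apply, pow_succ _ (l + 1), Matrix.mul_apply]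
    refine Fintype.sum_of_injective Subtype.val Subtype.val_injective _ _ (fun z hz => ?_)
      fun k' => ?_
    · rw [killed_pow_eq_zero_of_not_in1 i.2.1 l fun h => hz ⟨⟨z, h⟩, rfl⟩, zero_mul]
    · rw [ih k']
      simp [V11, Matrix.toBlock_apply, killed, k.2.2]

/-- The matrices `D(l)` collect first-return probabilities: unvisited states do not contribute to
paths that start in a visited state. -/
lemma D_succ_apply (l : ℕ) (i j : net.S0) :
    net.D (l + 1) i j = firstReturn AEmpty net.transZ l i.1 j.1 := by
  cases l with
  | zero => simp [D, V00, firstReturn, Matrix.toBlock_apply]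
  | succ l =>
    rw [firstReturn, Matrix.mul_apply, D, Matrix.mul_apply]
    refine Fintype.sum_of_injective Subtype.val Subtype.val_injective _ _ (fun z hz => ?_)
      fun k' => ?_
    · rw [killed_pow_eq_zero_of_not_in1 i.2.1 l fun h => hz ⟨⟨z, h⟩, rfl⟩, zero_mul]
    · rw [V01_mul_V11_pow l i k']
      simp [V10, Matrix.toBlock_apply]

end Network

section Driving

open Network

variable {Ω : Type*} [MeasurableSpace Ω] {μ : Measure Ω}
  {net : Network} {ls : ℕ} {x₀ : Ω → Vec ls} {C : ℕ → Ω → net.Chan} {γ γ' : ℕ → Ω → Bool}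

/-- The process `(C(t+1), γ(t), γ'(t))`. -/
def inp (C : ℕ → Ω → net.Chan) (γ γ' : ℕ → Ω → Bool) (t : ℕ) (ω : Ω) : net.Inp :=
  (C (t + 1) ω, γ t ω, γ' t ω)

/-- The process `Z(t)`. -/
def zProc (C : ℕ → Ω → net.Chan) (γ γ' : ℕ → Ω → Bool) (t : ℕ) (ω : Ω) : net.ZState :=
  zPath (fun s => inp C γ γ' s ω) t

namespace IsDrivingProcess

lemma measurable_inp (hd : IsDrivingProcess μ net x₀ C γ γ') (t : ℕ) :
    Measurable (inp C γ γ' t) :=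
  (hd.measurable_C _).prodMk ((hd.measurable_γ t).prodMk (hd.measurable_γ' t))

lemma measurable_zProc (hd : IsDrivingProcess μ net x₀ C γ γ') (t : ℕ) :
    Measurable (zProc C γ γ' t) :=
  measurable_of_dependsOn hd.measurable_inp (dependsOn_zPath t)

variable [IsProbabilityMeasure μ] (hd : IsDrivingProcess μ net x₀ C γ γ')
include hd

lemma measureReal_inp_path {A : Set (Vec ls)} (hA : MeasurableSet A) (m : ℕ) (x : ℕ → net.Inp) :
    μ.real {ω | x₀ ω ∈ A ∧ ∀ t ≤ m, inp C γ γ' t ω = x t} = μ.real (x₀ ⁻¹' A) *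
      (inpProb net.c₀ (x 0) * ∏ t ∈ Finset.range m, inpProb (x t).1 (x (t + 1))) := by
  have hY : Measurable fun ω => (C 0 ω, γ (m + 1) ω, γ' (m + 1) ω) :=
    (hd.measurable_C _).prodMk ((hd.measurable_γ _).prodMk (hd.measurable_γ' _))
  rw [measureReal_eq_sum_fiber hY]
  -- the cylinder event fixes `C` up to time `m + 1`, but the outcomes only up to time `m`
  have hterm : ∀ y : net.Inp,
      μ.real {ω | ω ∈ {ω | x₀ ω ∈ A ∧ ∀ t ≤ m, inp C γ γ' t ω = x t} ∧
        (C 0 ω, γ (m + 1) ω, γ' (m + 1) ω) = y} =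
      μ.real (x₀ ⁻¹' A) * (if y.1 = net.c₀ then 1 else 0) *
        ((∏ t ∈ Finset.range m, inpProb (x t).1 (x (t + 1))) * inpProb y.1 (x 0)) *
        (outcomeProb net.dropCA y.2.1 * outcomeProb (dropSC (x m).1) y.2.2) := by
    intro y
    have h := hd.law A hA (m + 1) (fun t => Nat.casesOn t y.1 fun s => (x s).1)
      (fun t => if t ≤ m then (x t).2.1 else y.2.1) (fun t => if t ≤ m then (x t).2.2 else y.2.2)
    have hset : {ω | ω ∈ {ω | x₀ ω ∈ A ∧ ∀ t ≤ m, inp C γ γ' t ω = x t} ∧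
        (C 0 ω, γ (m + 1) ω, γ' (m + 1) ω) = y} =
        {ω | x₀ ω ∈ A ∧ ∀ t ≤ m + 1, C t ω = (Nat.casesOn t y.1 fun s => (x s).1 : net.Chan) ∧
          γ t ω = (if t ≤ m then (x t).2.1 else y.2.1) ∧
          γ' t ω = (if t ≤ m then (x t).2.2 else y.2.2)} := by
      ext ω
      simp only [Set.mem_ofPred_eq, inp, Prod.ext_iff]
      constructor
      · rintro ⟨⟨h1, h2⟩, h3, h4, h5⟩
        refine ⟨h1, fun t ht => ⟨?_, ?_⟩⟩
        · cases t with
          | zero => exact h3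
          | succ s => exact (h2 s (by omega)).1
        · by_cases htm : t ≤ m
          · simpa [htm] using (h2 t htm).2
          · obtain rfl : t = m + 1 := by omega
            simpa using ⟨h4, h5⟩
      · rintro ⟨h1, h2⟩
        refine ⟨⟨h1, fun t ht => ⟨(h2 (t + 1) (by omega)).1, ?_⟩⟩, (h2 0 (by omega)).1, ?_⟩
        · simpa [ht] using (h2 t (by omega)).2
        · simpa using (h2 (m + 1) le_rfl).2
    rw [hset, h]
    have hprod : ∏ t ∈ Finset.range (m + 1 + 1),
        outcomeProb net.dropCA (if t ≤ m then (x t).2.1 else y.2.1) *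
          outcomeProb (dropSC (Nat.casesOn t y.1 fun s => (x s).1 : net.Chan))
            (if t ≤ m then (x t).2.2 else y.2.2) =
        (∏ t ∈ Finset.range m, outcomeProb net.dropCA (x (t + 1)).2.1 *
          outcomeProb (dropSC (x t).1) (x (t + 1)).2.2) *
          (outcomeProb net.dropCA (x 0).2.1 * outcomeProb (dropSC y.1) (x 0).2.2) *
          (outcomeProb net.dropCA y.2.1 * outcomeProb (dropSC (x m).1) y.2.2) := by
      rw [Finset.prod_range_succ, Finset.prod_range_succ']
      congr 1
      · congr 1
        refine Finset.prod_congr rfl fun t ht => ?_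
        have : t + 1 ≤ m := Finset.mem_range.1 ht
        simp only [if_pos this]
      · simp
    have hP : ∏ t ∈ Finset.range (m + 1), net.P (Nat.casesOn t y.1 fun s => (x s).1 : net.Chan)
        (x t).1 = (∏ t ∈ Finset.range m, net.P (x t).1 (x (t + 1)).1) * net.P y.1 (x 0).1 :=
      Finset.prod_range_succ' _ _
    change μ.real (x₀ ⁻¹' A) * (if y.1 = net.c₀ then 1 else 0) *
      (∏ t ∈ Finset.range (m + 1), net.P (Nat.casesOn t y.1 fun s => (x s).1 : net.Chan)
        (x t).1) * _ = _
    rw [hprod, hP]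
    simp only [inpProb, Finset.prod_mul_distrib]
    ring
  rw [Finset.sum_congr rfl fun y _ => hterm y, Fintype.sum_prod_type,
    Finset.sum_eq_single net.c₀]
  · simp only [if_true, mul_one, ← Finset.mul_sum]
    have hone : ∑ y : Bool × Bool,
        outcomeProb net.dropCA y.1 * outcomeProb (dropSC (x m).1) y.2 = 1 := by
      rw [Fintype.sum_prod_type]
      simp only [← Finset.mul_sum, sum_outcomeProb, mul_one]
    rw [hone]
    ring
  · intro c _ hc
    simp [hc]
  · simp

lemma measureReal_inp_path_univ (m : ℕ) (x : ℕ → net.Inp) :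
    μ.real {ω | ∀ t ≤ m, inp C γ γ' t ω = x t} =
      inpProb net.c₀ (x 0) * ∏ t ∈ Finset.range m, inpProb (x t).1 (x (t + 1)) := by
  have h := hd.measureReal_inp_path MeasurableSet.univ m x
  simpa using h

lemma isMarkovChain_inp : IsMarkovChain μ (inp C γ γ') fun x x' => inpProb x.1 x' :=
  isMarkovChain_of_pathLaw hd.measurable_inp hd.measureReal_inp_path_univ

lemma isMarkovChain_zProc : IsMarkovChain μ (zProc C γ γ') net.transZ := by
  intro m H hH z z'
  have hdep : DependsOn (fun x : ℕ → net.Inp => H (zPath x) ∧ zPath x m = z) (Set.Iic m) := by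
    intro x x' h
    have h1 : ∀ t ≤ m, zPath x t = zPath x' t := fun t ht =>
      dependsOn_zPath t fun s hs => h s (le_trans hs ht)
    have h2 : H (zPath x) = H (zPath x') := hH fun t ht => h1 t ht
    simp only [h2, h1 m le_rfl]
  have hx : ∀ x', μ.real {ω | (H (fun t => zProc C γ γ' t ω) ∧ zProc C γ γ' m ω = z) ∧
      inp C γ γ' (m + 1) ω = x'} =
      μ.real {ω | H (fun t => zProc C γ γ' t ω) ∧ zProc C γ γ' m ω = z} * inpProb z.2.2 x' := by
    intro x'
    rw [measureReal_eq_sum_fiber (hd.measurable_inp m),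
      measureReal_eq_sum_fiber (hd.measurable_inp m)
        {ω | H (fun t => zProc C γ γ' t ω) ∧ zProc C γ γ' m ω = z}, Finset.sum_mul]
    refine Finset.sum_congr rfl fun x _ => ?_
    have h := hd.isMarkovChain_inp m _ hdep x x'
    by_cases hxz : x.1 = z.2.2
    · rw [← hxz]
      rw [show {ω | ω ∈ {ω | (H (fun t => zProc C γ γ' t ω) ∧ zProc C γ γ' m ω = z) ∧
        inp C γ γ' (m + 1) ω = x'} ∧ inp C γ γ' m ω = x} =
        {ω | (H (zPath fun t => inp C γ γ' t ω) ∧ zPath (fun t => inp C γ γ' t ω) m = z) ∧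
          inp C γ γ' m ω = x ∧ inp C γ γ' (m + 1) ω = x'} from ?_]
      · exact h
      · ext ω
        simp only [Set.mem_ofPred_eq]
        constructor
        · rintro ⟨⟨a, b⟩, c⟩
          exact ⟨a, c, b⟩
        · rintro ⟨a, c, b⟩
          exact ⟨⟨a, b⟩, c⟩
    · have hne : ∀ ω, zProc C γ γ' m ω = z → inp C γ γ' m ω ≠ x := by
        intro ω h1 h2
        apply hxz
        rw [← h1, ← h2]
        exact (zPath_chan (fun s => inp C γ γ' s ω) m).symm
      have e1 : {ω | ω ∈ {ω | (H (fun t => zProc C γ γ' t ω) ∧ zProc C γ γ' m ω = z) ∧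
        inp C γ γ' (m + 1) ω = x'} ∧ inp C γ γ' m ω = x} = ∅ :=
        Set.eq_empty_of_forall_notMem fun ω h => hne ω h.1.1.2 h.2
      have e2 : {ω | ω ∈ {ω | H (fun t => zProc C γ γ' t ω) ∧ zProc C γ γ' m ω = z} ∧
        inp C γ γ' m ω = x} = ∅ :=
        Set.eq_empty_of_forall_notMem fun ω h => hne ω h.1.2 h.2
      rw [e1, e2]
      simp
  rw [measureReal_eq_sum_fiber (hd.measurable_inp (m + 1)), transZ_eq, Finset.mul_sum]
  refine Finset.sum_congr rfl fun x' _ => ?_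
  split_ifs with hs
  · rw [← hx x']
    congr 1
    ext ω
    simp only [Set.mem_ofPred_eq]
    constructor
    · rintro ⟨⟨a, b, -⟩, c⟩
      exact ⟨⟨a, b⟩, c⟩
    · rintro ⟨⟨a, b⟩, c⟩
      refine ⟨⟨a, b, ?_⟩, c⟩
      rw [← hs, ← b, ← c]
      rfl
  · rw [mul_zero]
    convert measureReal_empty (μ := μ)
    refine Set.eq_empty_of_forall_notMem fun ω h => hs ?_
    rw [← h.1.2.2, ← h.1.2.1, ← h.2]
    rfl

lemma measureReal_chan_one (c : net.Chan) : μ.real {ω | C 1 ω = c} = net.P net.c₀ c := by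
  have hY : Measurable fun ω => (γ 0 ω, γ' 0 ω) :=
    (hd.measurable_γ 0).prodMk (hd.measurable_γ' 0)
  rw [measureReal_eq_sum_fiber hY]
  have h : ∀ y : Bool × Bool, μ.real {ω | ω ∈ {ω | C 1 ω = c} ∧ (γ 0 ω, γ' 0 ω) = y} =
      net.P net.c₀ c *
        (outcomeProb net.dropCA y.1 * outcomeProb (dropSC net.c₀) y.2) := by
    intro y
    have h := hd.measureReal_inp_path_univ 0 fun _ => (c, y)
    simp only [Finset.range_zero, Finset.prod_empty, mul_one, inpProb] at h
    rw [← mul_assoc, ← h]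
    congr 1
    ext ω
    simp [inp, Prod.ext_iff]
  simp only [h, Fintype.sum_prod_type, ← Finset.mul_sum, sum_outcomeProb, mul_one]

lemma measure_zProc_zero_of_not_visited {z : net.ZState} (hz : ¬ net.Visited z) :
    μ {ω | zProc C γ γ' 0 ω = z} = 0 := by
  by_cases hz0 : z.1 = 0 ∧ z.2.1 = 0
  · have hP : net.P net.c₀ z.2.2 = 0 := by
      refine le_antisymm (not_lt.1 fun h => hz ⟨z.2.2, 0, h, ?_⟩) (P_nonneg _ _)
      have : ((0, 0, z.2.2) : net.ZState) = z := by
        rw [← hz0.1, ← hz0.2]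
      rw [this]
      simp
    have h := hd.measureReal_chan_one z.2.2
    rw [hP, measureReal_eq_zero_iff] at h
    refine measure_mono_null (fun ω hω => ?_) h
    rw [Set.mem_ofPred_eq, ← show zProc C γ γ' 0 ω = z from hω]
    rfl
  · convert measure_empty (μ := μ)
    refine Set.eq_empty_of_forall_notMem fun ω h => hz0 ?_
    rw [← show zProc C γ γ' 0 ω = z from h]
    exact ⟨rfl, rfl⟩

lemma exists_measure_zProc_ne_zero {z : net.ZState} (hz : net.Visited z) :
    ∃ t, μ {ω | zProc C γ γ' t ω = z} ≠ 0 := by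
  obtain ⟨c, t, hc, ht⟩ := hz
  refine ⟨t, ?_⟩
  induction t generalizing z with
  | zero =>
    rw [pow_zero, Matrix.one_apply] at ht
    by_cases hzc : ((0, 0, c) : net.ZState) = z
    · have h := hd.measureReal_chan_one c
      intro h0
      refine hc.ne' ?_
      rw [← h, measureReal_eq_zero_iff]
      refine measure_mono_null (fun ω hω => ?_) h0
      rw [Set.mem_ofPred_eq, ← hzc, ← show C 1 ω = c from hω]
      rfl
    · simp [hzc] at ht
  | succ t ih =>
    rw [pow_succ, Matrix.mul_apply] at ht
    obtain ⟨k, -, hk⟩ := Finset.exists_ne_zero_of_sum_ne_zero ht.ne'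
    have h1 := ih (z := k) (lt_of_le_of_ne (pow_apply_nonneg transZ_nonneg _ _ _)
      (left_ne_zero_of_mul hk).symm)
    have hT : DependsOn (fun _ : ℕ → net.ZState => True) (Set.Iic t) := fun _ _ _ => rfl
    have h2 := hd.isMarkovChain_zProc t _ hT k z
    intro h0
    have h3 : μ.real {ω | True ∧ zProc C γ γ' t ω = k ∧ zProc C γ γ' (t + 1) ω = z} = 0 := by
      rw [measureReal_eq_zero_iff]
      exact measure_mono_null (fun ω hω => hω.2.2) h0
    rw [h3] at h2
    rcases mul_eq_zero.1 h2.symm with h | h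
    · rw [measureReal_eq_zero_iff] at h
      simp only [true_and] at h
      exact h1 h
    · exact right_ne_zero_of_mul hk h

lemma ae_infinite_aEmpty : ∀ᵐ ω ∂μ, {t | AEmpty (zProc C γ γ' t ω)}.Infinite := by
  have hq : 0 < net.dropCA ^ (net.Λa + 1) := pow_pos net.dropCA_pos _
  have hq1 : net.dropCA ^ (net.Λa + 1) ≤ 1 := pow_le_one₀ net.dropCA_pos.le net.dropCA_le_one
  refine hd.isMarkovChain_zProc.ae_infinite_visits AEmpty hd.measurable_zProc transZ_nonneg
    (N := net.Λa + 1) (θ := 1 - net.dropCA ^ (net.Λa + 1)) (by linarith) (by linarith) fun z => ?_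
  exact sum_killed_pow_le_of_la_le net.Λa z z.2.1.2.le

/-- The initial plant state is independent of functionals of the network up to time `t`. -/
lemma lintegral_mul_eq {φ : Vec ls → ℝ≥0∞} (hφ : Measurable φ) {t : ℕ}
    {F : (ℕ → net.Inp) → ℝ≥0∞} (hF : DependsOn F (Set.Iic t)) :
    ∫⁻ ω, φ (x₀ ω) * F (fun s => inp C γ γ' s ω) ∂μ =
      (∫⁻ ω, φ (x₀ ω) ∂μ) * ∫⁻ ω, F (fun s => inp C γ γ' s ω) ∂μ := by
  have hseg := measurable_initSeg hd.measurable_inp t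
  have hind : IndepFun x₀ (fun ω => initSeg t fun s => inp C γ γ' s ω) μ := by
    rw [indepFun_iff_measure_inter_preimage_eq_mul]
    intro A B hA hB
    have hw : ∀ w : Fin (t + 1) → net.Inp,
        μ (x₀ ⁻¹' A ∩ (fun ω => initSeg t fun s => inp C γ γ' s ω) ⁻¹' {w}) =
          μ (x₀ ⁻¹' A) * μ ((fun ω => initSeg t fun s => inp C γ γ' s ω) ⁻¹' {w}) := by
      intro w
      have h1 := hd.measureReal_inp_path hA t (extendSeg w)
      rw [← hd.measureReal_inp_path_univ t (extendSeg w)] at h1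
      simp only [← initSeg_eq_iff (fun s => inp C γ γ' s _) w] at h1
      rw [← ENNReal.toReal_eq_toReal_iff' (measure_ne_top _ _)
        (ENNReal.mul_ne_top (measure_ne_top _ _) (measure_ne_top _ _)), ENNReal.toReal_mul]
      exact h1
    have hsum : ∀ D : Set Ω, μ (D ∩ (fun ω => initSeg t fun s => inp C γ γ' s ω) ⁻¹' B) =
        ∑ w ∈ B.toFinite.toFinset,
          μ (D ∩ (fun ω => initSeg t fun s => inp C γ γ' s ω) ⁻¹' {w}) := by
      intro D
      have h := sum_measure_preimage_singleton (μ := μ.restrict D) B.toFinite.toFinset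
        (f := fun ω => initSeg t fun s => inp C γ γ' s ω)
        fun w _ => hseg (measurableSet_singleton w)
      rw [Set.Finite.coe_toFinset, Measure.restrict_apply (hseg hB), Set.inter_comm] at h
      rw [← h]
      refine Finset.sum_congr rfl fun w _ => ?_
      rw [Measure.restrict_apply (hseg (measurableSet_singleton w)), Set.inter_comm]
    have huniv := hsum Set.univ
    simp only [Set.univ_inter] at huniv
    rw [hsum, huniv, Finset.mul_sum]
    exact Finset.sum_congr rfl fun w _ => hw w
  have hG : Measurable fun w : Fin (t + 1) → net.Inp => F (extendSeg w) := .of_discrete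
  have h := lintegral_mul_eq_lintegral_mul_lintegral_of_indepFun (hφ.comp hd.measurable_x₀)
    (hG.comp hseg) (hind.comp hφ hG)
  simpa only [Pi.mul_apply, Function.comp_apply, dependsOn_extendSeg hF] using h

end IsDrivingProcess

end Driving

/-! ### Plant, buffers and the Lyapunov function -/

open Network

section Loop

variable {ls lu : ℕ} {net : Network} {f : Vec ls → Vec lu → Vec ls} {κ : Vec ls → Vec lu}

lemma length_plan (n : ℕ) (x : Vec ls) : (plan f κ n x).length = n := by
  induction n generalizing x with
  | zero => rfl
  | succ n ih => simp [plan, ih]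

lemma take_plan (k n : ℕ) (x : Vec ls) : (plan f κ n x).take k = plan f κ (min k n) x := by
  induction n generalizing x k with
  | zero => simp [plan]
  | succ n ih =>
    cases k with
    | zero => simp [plan]
    | succ k => simp [plan, ih, Nat.succ_min_succ]

lemma length_nextBc (x : Vec ls) (bc ba : List (Vec lu)) (c : net.Chan) (g g' : Bool) :
    (nextBc net f κ x bc ba c g g').length = net.nextLc bc.length ba.length c g g' := by
  unfold nextBc nextLc
  dsimp only
  split_ifs <;> simp [length_plan]

lemma length_nextBa (x : Vec ls) (bc ba : List (Vec lu)) (c : net.Chan) (g g' : Bool) :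
    (nextBa net f κ x bc ba c g g').length = net.nextLa bc.length ba.length c g g' := by
  unfold nextBa nextLa numSent
  dsimp only
  split_ifs <;> (simp [length_plan]; try omega)

/-- A nonempty actuator buffer, followed by the controller buffer, is a plan from the current
plant state. -/
def BuffersFollowPlan (f : Vec ls → Vec lu → Vec ls) (κ : Vec ls → Vec lu)
    (s : LoopState ls lu) : Prop :=
  s.ba ≠ [] → ∃ n, s.ba ++ s.bc = plan f κ n s.x

lemma BuffersFollowPlan.tail {s : LoopState ls lu} (h : BuffersFollowPlan f κ s)
    (hs : s.ba ≠ []) :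
    s.input = κ s.x ∧ ∃ n, s.ba.tail ++ s.bc = plan f κ n (f s.x s.input) := by
  obtain ⟨n, hn⟩ := h hs
  obtain ⟨u, l, hl⟩ := List.exists_cons_of_ne_nil hs
  rw [hl] at hn
  cases n with
  | zero => simp [plan] at hn
  | succ n =>
    simp only [plan, List.cons_append, List.cons.injEq] at hn
    have hin : s.input = κ s.x := by simp [LoopState.input, hl, hn.1]
    refine ⟨hin, n, ?_⟩
    rw [hin, hl, List.tail_cons, hn.2]

/-- Dropping or not receiving packets only shortens the stored plan or delays its transfer, so the
buffers keep following the plan. -/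
lemma BuffersFollowPlan.next {s : LoopState ls lu} (h : BuffersFollowPlan f κ s)
    (c : net.Chan) (g g' : Bool) :
    BuffersFollowPlan f κ ⟨f s.x s.input, nextBc net f κ (f s.x s.input) s.bc s.ba c g g',
      nextBa net f κ (f s.x s.input) s.bc s.ba c g g'⟩ := by
  intro hne
  dsimp only at hne ⊢
  unfold nextBa at hne ⊢
  unfold nextBc
  dsimp only at hne ⊢
  have hnil : s.ba.length = 0 → s.ba.tail = [] := fun h0 => by
    rw [List.eq_nil_of_length_eq_zero h0, List.tail_nil]
  have htail : s.ba.tail ≠ [] → ∃ n, s.ba.tail ++ s.bc = plan f κ n (f s.x s.input) := by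
    intro ht
    refine (h.tail fun h0 => ht ?_).2
    rw [h0, List.tail_nil]
  by_cases hF : Fresh c g'
  · cases g with
    | true =>
      simp only [if_pos hF, if_true, Bool.true_eq_false, if_false, List.take_append_drop]
      exact ⟨_, rfl⟩
    | false =>
      simp only [if_true] at hne
      obtain ⟨n, hn⟩ := htail hne
      refine ⟨min s.ba.tail.length n, ?_⟩
      simp only [if_pos hF, if_true, Bool.false_eq_true, if_false, List.append_nil]
      rw [← take_plan, ← hn, List.take_left']
      rfl
  · by_cases h0 : s.ba.length = 0
    · refine absurd ?_ hne
      simp only [if_neg hF, if_pos h0, hnil h0, ite_self]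
    · obtain ⟨n, hn⟩ := (h.tail fun h1 => h0 (by rw [h1]; rfl)).2
      refine ⟨n, ?_⟩
      rw [← hn]
      cases g <;> simp [hF, h0]

lemma buffersFollowPlan_evolve (x₀ : Vec ls) (c : ℕ → net.Chan) (g g' : ℕ → Bool) (t : ℕ) :
    BuffersFollowPlan f κ (evolve net f κ x₀ c g g' t) := by
  induction t with
  | zero => exact fun h => absurd rfl h
  | succ t ih => exact ih.next _ _ _

end Loop

section RandomLoop

variable {Ω : Type*} {ls lu : ℕ} {net : Network} {f : Vec ls → Vec lu → Vec ls}
  {κ : Vec ls → Vec lu} {x₀ : Ω → Vec ls} {C : ℕ → Ω → net.Chan} {γ γ' : ℕ → Ω → Bool}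

lemma length_buffers (t : ℕ) (ω : Ω) :
    lamC net f κ x₀ C γ γ' t ω = (zProc C γ γ' t ω).1 ∧
      lamA net f κ x₀ C γ γ' t ω = (zProc C γ γ' t ω).2.1 := by
  induction t with
  | zero => exact ⟨rfl, rfl⟩
  | succ t ih =>
    obtain ⟨h1, h2⟩ := ih
    have h3 : (zProc C γ γ' t ω).2.2 = C (t + 1) ω := zPath_chan (fun s => inp C γ γ' s ω) t
    constructor
    · refine (length_nextBc _ _ _ _ _ _).trans ?_
      change net.nextLc (lamC net f κ x₀ C γ γ' t ω) (lamA net f κ x₀ C γ γ' t ω)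
        (C (t + 1) ω) (γ (t + 1) ω) (γ' (t + 1) ω) = _
      rw [h1, h2, ← h3]
      rfl
    · refine (length_nextBa _ _ _ _ _ _).trans ?_
      change net.nextLa (lamC net f κ x₀ C γ γ' t ω) (lamA net f κ x₀ C γ γ' t ω)
        (C (t + 1) ω) (γ (t + 1) ω) (γ' (t + 1) ω) = _
      rw [h1, h2, ← h3]
      rfl

lemma lamA_eq_zero_iff (t : ℕ) (ω : Ω) :
    lamA net f κ x₀ C γ γ' t ω = 0 ↔ AEmpty (zProc C γ γ' t ω) := by
  rw [(length_buffers t ω).2]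
  exact Fin.val_eq_zero_iff

lemma zEq_iff (t : ℕ) (ω : Ω) (z : net.ZState) :
    ZEq net f κ x₀ C γ γ' t ω z ↔ zProc C γ γ' t ω = z := by
  have h3 : (zProc C γ γ' t ω).2.2 = C (t + 1) ω := zPath_chan (fun s => inp C γ γ' s ω) t
  rw [ZEq, (length_buffers t ω).1, (length_buffers t ω).2, ← h3]
  simp only [Prod.ext_iff, Fin.ext_iff]

lemma k_eq_visitTime (n : ℕ) (ω : Ω) :
    k net f κ x₀ C γ γ' n ω = visitTime (zProc C γ γ') AEmpty n ω := by
  simp only [k, visitTime, lamA_eq_zero_iff]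

lemma cycleEvent_eq (n : ℕ) (i j : net.S0) :
    cycleEvent net f κ x₀ C γ γ' n i j = successive (zProc C γ γ') AEmpty n i.1 j.1 := by
  ext ω
  simp only [cycleEvent, successive, zEq_iff, k_eq_visitTime]

/-- The Lyapunov function contracts while the actuator buffer is nonempty, because the buffered
command is the one that the policy would choose. -/
lemma lyapunov_le_weight {V : Vec ls → ℝ≥0} {ψ₁ ψ₂ : ℝ≥0 → ℝ≥0} {ρ α : ℝ}
    (hV : LyapunovControllable f V ψ₁ ψ₂ ρ κ) (hα : OpenLoopBound f V α) (t : ℕ) (ω : Ω) :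
    (V (state net f κ x₀ C γ γ' t ω) : ℝ≥0∞) ≤ V (x₀ ω) *
      weight (fun z : net.ZState => if AEmpty z then α else ρ) (fun s => zProc C γ γ' s ω) t := by
  induction t with
  | zero => simp [weight, state, loop, evolve]
  | succ t ih =>
    have hinv : BuffersFollowPlan f κ (loop net f κ x₀ C γ γ' t ω) :=
      buffersFollowPlan_evolve _ _ _ _ t
    set s := loop net f κ x₀ C γ γ' t ω with hs
    have hstep : (V (f s.x s.input) : ℝ) ≤
        (if AEmpty (zProc C γ γ' t ω) then α else ρ) * V s.x := by
      have hlen := lamA_eq_zero_iff (net := net) (f := f) (κ := κ) (x₀ := x₀) (C := C) (γ := γ)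
        (γ' := γ') t ω
      split_ifs with h0
      · have hba : s.ba = [] := List.eq_nil_of_length_eq_zero (hlen.2 h0)
        have hin : s.input = 0 := by simp [LoopState.input, hba]
        rw [hin]
        exact hα.growth _
      · have hba : s.ba ≠ [] := fun h1 => h0 (hlen.1 (by rw [lamA, ← hs, h1]; rfl))
        rw [(hinv.tail hba).1]
        exact hV.contract _
    have hstep' : (V (f s.x s.input) : ℝ≥0∞) ≤
        ENNReal.ofReal (if AEmpty (zProc C γ γ' t ω) then α else ρ) * V s.x := by
      rw [← ENNReal.ofReal_coe_nnreal, ← ENNReal.ofReal_coe_nnreal (p := V s.x),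
        ← ENNReal.ofReal_mul' (NNReal.coe_nonneg _)]
      exact ENNReal.ofReal_le_ofReal hstep
    change (V (f s.x s.input) : ℝ≥0∞) ≤ _
    refine hstep'.trans ?_
    rw [weight, Finset.prod_range_succ, ← mul_assoc, mul_comm]
    exact mul_le_mul_left ih _

end RandomLoop

lemma r_eq {net : Network} (ρ : ℝ) (i j : net.S0) :
    net.r ρ i j = (∑' l, ρ ^ (l + 1) * firstReturn AEmpty net.transZ l i.1 j.1) /
      ∑' l, firstReturn AEmpty net.transZ l i.1 j.1 := by
  simp only [r, Vtilde, D_succ_apply]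

/-- A return from `i` to the empty buffer carries the discounted mass `∑ⱼ r i j * Ṽ i j`, and the
row sums of `Ṽ` are at most `1`. -/
lemma discounted_return_le_OmegaPrime {net : Network} {ρ α : ℝ} (hρ0 : 0 < ρ) (hρ1 : ρ < 1)
    (hα : 0 < α) {i : net.ZState} (hi : net.Visited i) (hE : AEmpty i) :
    α * ∑' l, ρ ^ l * ∑ j with AEmpty j, firstReturn AEmpty net.transZ l i j ≤
      net.OmegaPrime α ρ := by
  set i' : net.S0 := ⟨i, hi, hE⟩ with hi'
  set M : ℝ := ⨆ p : net.S0 × net.S0, net.r ρ p.1 p.2 with hM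
  set d : ℕ → net.ZState → ℝ := fun l j => firstReturn AEmpty net.transZ l i j with hdef
  have hd0 : ∀ l j, 0 ≤ d l j := fun l j => firstReturn_nonneg AEmpty transZ_nonneg l i j
  have hd : ∀ j, AEmpty j → Summable fun l => d l j := fun j hj =>
    summable_firstReturn AEmpty transZ_nonneg sum_transZ i hj
  have hdρ : ∀ j, AEmpty j → Summable fun l => ρ ^ l * d l j := fun j hj =>
    Summable.of_nonneg_of_le (fun l => mul_nonneg (pow_nonneg hρ0.le l) (hd0 l j))
      (fun l => mul_le_of_le_one_left (hd0 l j) (pow_le_one₀ hρ0.le hρ1.le)) (hd j hj)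
  have hr : ∀ p : net.S0 × net.S0, net.r ρ p.1 p.2 ≤ M := fun p =>
    le_ciSup (f := fun p : net.S0 × net.S0 => net.r ρ p.1 p.2) (Set.finite_range _).bddAbove p
  have hM0 : 0 ≤ M := by
    refine le_trans ?_ (hr (i', i'))
    rw [r_eq]
    exact div_nonneg (tsum_nonneg fun l => mul_nonneg (pow_nonneg hρ0.le _) (hd0 l i))
      (tsum_nonneg fun l => hd0 l i)
  have hterm : ∀ j, AEmpty j → ∑' l, ρ ^ l * d l j ≤ ρ⁻¹ * M * ∑' l, d l j := by
    intro j hj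
    have hfact : ∑' l, ρ ^ (l + 1) * d l j = ρ * ∑' l, ρ ^ l * d l j := by
      rw [← tsum_mul_left]
      refine tsum_congr fun l => ?_
      rw [pow_succ]
      ring
    by_cases hj0 : ∑' l, d l j = 0
    · have hz : ∀ l, d l j = 0 := fun l =>
        congrFun (((hd j hj).hasSum_iff.2 hj0 |> (hasSum_zero_iff_of_nonneg fun l => hd0 l j).1)) l
      simp [hz]
    · -- an entry with positive mass belongs to a visited state, hence to `S0`
      obtain ⟨l, hl⟩ : ∃ l, d l j ≠ 0 := by
        by_contra! h
        exact hj0 (by simp [h])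
      have hjv : net.Visited j := visited_of_firstReturn_ne_zero hi hl
      have h1 := hr (i', ⟨j, hjv, hj⟩)
      rw [r_eq, div_le_iff₀ (lt_of_le_of_ne (tsum_nonneg fun l => hd0 l j) (Ne.symm hj0))] at h1
      have h2 : ρ * ∑' l, ρ ^ l * d l j ≤ M * ∑' l, d l j := by
        rw [← hfact]
        exact h1
      rw [mul_assoc, ← div_eq_inv_mul, le_div_iff₀' hρ0]
      exact h2
  have hswap : ∑' l, ρ ^ l * ∑ j with AEmpty j, d l j =
      ∑ j with AEmpty j, ∑' l, ρ ^ l * d l j := by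
    simp only [Finset.mul_sum]
    exact Summable.tsum_finsetSum fun j hj => hdρ j (Finset.mem_filter.1 hj).2
  change α * ∑' l, ρ ^ l * ∑ j with AEmpty j, d l j ≤ α / ρ * M
  rw [hswap]
  calc α * ∑ j with AEmpty j, ∑' l, ρ ^ l * d l j
      ≤ α * ∑ j with AEmpty j, ρ⁻¹ * M * ∑' l, d l j := by
        refine mul_le_mul_of_nonneg_left (Finset.sum_le_sum fun j hj => ?_) hα.le
        exact hterm j (Finset.mem_filter.1 hj).2
    _ = α * (ρ⁻¹ * M) * ∑ j with AEmpty j, ∑' l, d l j := by rw [← Finset.mul_sum, ← mul_assoc]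
    _ ≤ α * (ρ⁻¹ * M) * 1 := by
        refine mul_le_mul_of_nonneg_left
          (sum_tsum_firstReturn_le AEmpty transZ_nonneg sum_transZ i) ?_
        have := inv_pos.2 hρ0
        positivity
    _ = α / ρ * M := by
        rw [div_eq_mul_inv]
        ring

end Anytime

open Anytime Anytime.Network in
theorem theorem1 {ls lu : ℕ}
    (f : Anytime.Vec ls → Anytime.Vec lu → Anytime.Vec ls)
    (V : Anytime.Vec ls → ℝ≥0) (ψ₁ ψ₂ : ℝ≥0 → ℝ≥0) (ρ α : ℝ)
    (κ : Anytime.Vec ls → Anytime.Vec lu)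
    (hV : Anytime.LyapunovControllable f V ψ₁ ψ₂ ρ κ)
    (hα : Anytime.OpenLoopBound f V α)
    (net : Anytime.Network)
    (hirr : net.P.IsIrreducible) (haper : Anytime.Aperiodic net.P)
    {Ω : Type*} [MeasurableSpace Ω] (μ : Measure Ω) [IsProbabilityMeasure μ]
    (x₀ : Ω → Anytime.Vec ls) (C : ℕ → Ω → net.Chan) (γ γ' : ℕ → Ω → Bool)
    (hdrive : Anytime.IsDrivingProcess μ net x₀ C γ γ')
    (hx₀ : ∫⁻ ω, (ψ₂ ‖x₀ ω‖₊ : ℝ≥0∞) ∂μ < ∞) :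
    -- the times `k_n` are well defined almost surely
    (∀ᵐ ω ∂μ, {t | Anytime.lamA net f κ x₀ C γ γ' t ω = 0}.Infinite) ∧
    -- `r i j` is the conditional expectation of `ρ ^ Δ_{n+1}` given `Z(k_n) = i, Z(k_{n+1}) = j`
    (∀ i j : net.S0,
      (∀ n : ℕ, μ (Anytime.cycleEvent net f κ x₀ C γ γ' n i j) ≠ 0 →
        ∫ ω, ρ ^ Anytime.cycleLength net f κ x₀ C γ γ' n ω
          ∂(cond μ (Anytime.cycleEvent net f κ x₀ C γ γ' n i j)) = net.r ρ i j) ∧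
      (net.Vtilde i j ≠ 0 →
        ∃ n : ℕ, μ (Anytime.cycleEvent net f κ x₀ C γ γ' n i j) ≠ 0)) ∧
    -- the sufficient condition for stability
    (net.OmegaPrime α ρ < 1 →
      Anytime.StochasticallyStable μ (Anytime.state net f κ x₀ C γ γ')) := by
  have hM := hdrive.isMarkovChain_zProc
  have hZ := hdrive.measurable_zProc
  have hinf := hdrive.ae_infinite_aEmpty
  have hρ0 := hV.rho_pos
  have hρ1 := hV.rho_lt_one
  refine ⟨?_, fun i j => ⟨fun n hn => ?_, fun hij => ?_⟩, fun hΩ => ?_⟩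
  · simpa only [lamA_eq_zero_iff] using hinf
  · rw [cycleEvent_eq] at hn ⊢
    simp only [cycleLength, k_eq_visitTime]
    rw [hM.integral_cond_cycle AEmpty hZ transZ_nonneg sum_transZ hinf (g := fun l => ρ ^ l)
      (fun l => ?_) n i.2.2 j.2.2 hn, r_eq]
    rw [norm_pow, Real.norm_of_nonneg hρ0.le]
    exact pow_le_one₀ hρ0.le hρ1.le
  · obtain ⟨l, hl⟩ : ∃ l, firstReturn AEmpty net.transZ l i.1 j.1 ≠ 0 := by
      by_contra! h
      exact hij (by simp [Vtilde, D_succ_apply, h])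
    obtain ⟨m, hm⟩ := hdrive.exists_measure_zProc_ne_zero i.2.1
    simp only [cycleEvent_eq]
    exact hM.exists_cycle_ne_zero AEmpty hZ i.2.2 j.2.2 hm hl
  · obtain ⟨h, hh0, hh⟩ := exists_testFunction AEmpty (R := net.Visited) transZ_nonneg sum_transZ
      hρ0 hρ1 hα.alpha_pos hΩ fun i hi hE =>
        discounted_return_le_OmegaPrime hρ0 hρ1 hα.alpha_pos hi hE
    have hsum := hM.tsum_lintegral_weight_lt_top hZ transZ_nonneg
      (a := fun z => if AEmpty z then α else ρ)
      (fun z => by split_ifs; exacts [hα.alpha_pos.le, hρ0.le]) hh0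
      (fun z hz => hdrive.measure_zProc_zero_of_not_visited hz) (fun z z' hz => hz.step) hh
    refine ⟨ψ₁, hV.classK₁, ?_⟩
    have hψ : Measurable fun x : Vec ls => (ψ₂ ‖x‖₊ : ℝ≥0∞) :=
      (measurable_coe_nnreal_ennreal.comp
        (hV.classK₂.continuous.comp continuous_nnnorm).measurable)
    refine lt_of_le_of_lt (ENNReal.tsum_le_tsum fun t => ?_)
      ((ENNReal.tsum_mul_left).trans_lt (ENNReal.mul_lt_top hx₀ hsum))
    have hdep : DependsOn (fun x : ℕ → net.Inp =>
        weight (fun z : net.ZState => if AEmpty z then α else ρ) (zPath x) t) (Set.Iic t) := by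
      intro x x' hxx
      exact dependsOn_weight _ t fun s hs =>
        dependsOn_zPath s fun r hr => hxx r ((Set.mem_Iic.1 hr).trans (Set.mem_Iic.1 hs))
    refine le_trans (lintegral_mono fun ω => ?_) (hdrive.lintegral_mul_eq hψ hdep).le
    refine le_trans (ENNReal.coe_le_coe.2 (hV.lower _))
      ((lyapunov_le_weight hV hα t ω).trans ?_)
    exact mul_le_mul_left (ENNReal.coe_le_coe.2 (hV.upper _)) _
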